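/- A topological group $G$ is Polish if its topology is separable and completely metrizable; a Polish group is TSI if it admits a compatible two-sided invariant metric, and non-archimedean if its identity has a neighbourhood basis consisting of open subgroups. For equivalence relations $E,F$ on Polish spaces $X,Y$, write $E\le_B F$ if there is a Borel map $f:X\to Y$ with $x\,E\,y\iff f(x)\,F\,f(y)$ for all $x,y\in X$; write $E\sim_B F$ if $E\le_B F$ and $F\le_B E$; and write $E<_B F$ if $E\le_B F$ and $F\not\le_B E$. Let $E_0$ be the relation of eventual equality on $2^\omega$, let $E_0^\omega$ be the relation on $(2^\omega)^\omega$ given by $x\,E_0^\omega\,y\iff\forall n\,(x(n)\,E_0\,y(n))$, and let $\mathbb R^\omega/c_0$ be the relation on $\mathbb R^\omega$ under which $x,y$ are equivalent iff $\lim_n (x(n)-y(n))=0$. For a Polish group $G$, let $E(G)$ be the relation on $G^\omega$ given by $x\,E(G)\,y$ iff the sequence $x(n)y(n)^{-1}$ converges in $G$. **Theorem.** Let $G$ be a Polish group. Then the following are equivalent: 1. $G$ is TSI and non-archimedean; 2. $E(G)\le_B E_0^\omega$; 3. $E(G)\le_B \mathbb R^\omega/c_0$. Moreover, $E(G)\sim_B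 E_0^\omega$ if and only if $G$ is TSI, uncountable and non-archimedean. In particular, there is no Polish group $G$ such that $E_0^\omega <_B E(G)\le_B \mathbb R^\omega/c_0$. -/

import Mathlib

open Filter Topology

/-- Borel reducibility `E ≤_B F` of equivalence relations on (Polish) topological spaces:
there is a Borel map `f : X → Y` with `x E y ↔ f x F f y`. -/
def BorelReducible {X Y : Type*} [TopologicalSpace X] [TopologicalSpace Y]
    (E : Setoid X) (F : Setoid Y) : Prop :=
  ∃ f : X → Y, @Measurable X Y (borel X) (borel Y) f ∧ ∀ x y : X, E x y ↔ F (f x) (f y)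

/-- `E ~_B F`. -/
def BorelBireducible {X Y : Type*} [TopologicalSpace X] [TopologicalSpace Y]
    (E : Setoid X) (F : Setoid Y) : Prop :=
  BorelReducible E F ∧ BorelReducible F E

/-- `E <_B F`. -/
def StrictlyBorelReducible {X Y : Type*} [TopologicalSpace X] [TopologicalSpace Y]
    (E : Setoid X) (F : Setoid Y) : Prop :=
  BorelReducible E F ∧ ¬ BorelReducible F E

/-- The relation `E₀` of eventual equality on `2^ω`. -/
def eqvE0 : Setoid (ℕ → Bool) where
  r x y := ∃ m : ℕ, ∀ n > m, x n = y n
  iseqv :=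
    { refl := fun _ => ⟨0, fun _ _ => rfl⟩
      symm := fun ⟨m, h⟩ => ⟨m, fun n hn => (h n hn).symm⟩
      trans := fun ⟨m, h⟩ ⟨k, h'⟩ => ⟨max m k, fun n hn =>
        (h n (lt_of_le_of_lt (le_max_left m k) hn)).trans
          (h' n (lt_of_le_of_lt (le_max_right m k) hn))⟩ }

/-- The relation `E^ω` on `X^ω`: coordinatewise `E`-equivalence. -/
def eqvOmega {X : Type*} (E : Setoid X) : Setoid (ℕ → X) where
  r x y := ∀ n : ℕ, E (x n) (y n)
  iseqv :=
    { refl := fun x n => E.refl (x n)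
      symm := fun h n => E.symm (h n)
      trans := fun h h' n => E.trans (h n) (h' n) }

/-- The relation `ℝ^ω / c₀` on `ℝ^ω`: the difference converges to `0`. -/
def eqvRc0 : Setoid (ℕ → ℝ) where
  r x y := Tendsto (fun n => x n - y n) atTop (𝓝 0)
  iseqv :=
    { refl := fun x => by simp
      symm := fun {x y} h => by simpa using h.neg
      trans := fun {x y z} h h' => by simpa using h.add h' }

/-- The equivalence relation `E(G)` on `G^ω`: the sequence `x(n) y(n)⁻¹` converges in `G`. -/
def eqvGroup (G : Type*) [Group G] [TopologicalSpace G] [IsTopologicalGroup G] :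
    Setoid (ℕ → G) where
  r x y := ∃ g : G, Tendsto (fun n => x n * (y n)⁻¹) atTop (𝓝 g)
  iseqv :=
    { refl := fun x => ⟨1, by simpa using tendsto_const_nhds⟩
      symm := fun {x y} ⟨g, h⟩ => ⟨g⁻¹, by simpa using h.inv⟩
      trans := fun {x y z} ⟨g, h⟩ ⟨k, h'⟩ => ⟨g * k, by simpa [mul_assoc] using h.mul h'⟩ }

/-- `G` is TSI: it admits a compatible two-sided invariant metric. -/
def IsTSI (G : Type*) [Group G] [τ : TopologicalSpace G] : Prop :=
  ∃ d : MetricSpace G, d.toUniformSpace.toTopologicalSpace = τ ∧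
    (∀ g h k : G, dist (g * h) (g * k) = dist h k) ∧
    (∀ g h k : G, dist (h * g) (k * g) = dist h k)

/-! Everything passes through one intermediate condition, a countable basis of open normal subgroups
N_k at the identity. A ball of an invariant metric inside an open subgroup is conjugation invariant,
so it generates a normal subgroup there; conversely G embeds in the product of the discrete
quotients G/N_k.

Given such a basis, x(n)y(n)⁻¹ converges iff it is eventually constant modulo every N_k. Normality
rewrites this as eventual equality of x(n+1)⁻¹x(n) and y(n+1)⁻¹y(n) modulo N_k, which is E₀^ω after
coding countable quotients. Weighting column k by 2⁻ᵏ sends E₀^ω into ℝ^ω/c₀.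

The hard direction starts from a reduction θ to ℝ^ω/c₀, pulled back to sequences in a countable
discrete group. Near a generic x, estimates on θ are locally stable. A category argument shows that
late jumps by elements near 1 move the far coordinates of θ little
(`IsEstimateGeneric.exists_smallJumps`). Eventually constant multipliers preserve the E(G)-class, so
conjugates of these elements obey the same bound up to a factor 3
(`IsEstimateGeneric.exists_forall_abs_conj_jump_le`). In c₀, small changes living on successive
blocks of coordinates do not add up. If normal closures of small neighbourhoods left a fixed V, one
could walk by conjugates out of V and back to 1 infinitely often while θ stays c₀-equivalent to θ x;
the walk would then converge in G, which is absurd (`ReducesVia.false_of_mem_normalClosure`).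

If G is uncountable then no N_k is trivial, and E₀^ω embeds in E(G). If G is countable it is
discrete and E(G) is a countable union of closed sets, to which E₀^ω does not reduce. -/

/-- The identity has a decreasing countable neighbourhood basis of open normal subgroups. -/
def HasOpenNormalBasis (G : Type*) [Group G] [TopologicalSpace G] : Prop :=
  ∃ N : ℕ → Subgroup G, Antitone N ∧ (∀ k, (N k).Normal) ∧ (∀ k, IsOpen (N k : Set G)) ∧
    ∀ V ∈ 𝓝 (1 : G), ∃ k, (N k : Set G) ⊆ V

/-! ### Open normal subgroups versus invariant metrics. -/

section NormalBasis

variable {G : Type*} [Group G] [TopologicalSpace G] [IsTopologicalGroup G]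

theorem hasOpenNormalBasis_of_normalClosure [FirstCountableTopology G]
    (h : ∀ V ∈ 𝓝 (1 : G), ∃ U ∈ 𝓝 (1 : G), (Subgroup.normalClosure U : Set G) ⊆ V) :
    HasOpenNormalBasis G := by
  obtain ⟨T, hT⟩ := (𝓝 (1 : G)).exists_antitone_basis
  refine ⟨fun k => Subgroup.normalClosure (T k),
    fun i j hij => Subgroup.normalClosure_mono (hT.antitone hij),
    fun k => Subgroup.normalClosure_normal, fun k => ?_, fun V hV => ?_⟩
  · exact Subgroup.isOpen_of_mem_nhds _ (g := 1)
      (mem_of_superset (hT.1.mem_of_mem trivial) Subgroup.subset_normalClosure)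
  · obtain ⟨U, hU, hUV⟩ := h V hV
    obtain ⟨k, -, hk⟩ := hT.1.mem_iff.1 hU
    exact ⟨k, fun x hx => hUV (Subgroup.normalClosure_mono hk hx)⟩

theorem IsTSI.exists_conj_invariant_subset (h : IsTSI G) {V : Set G} (hV : V ∈ 𝓝 (1 : G)) :
    ∃ B ∈ 𝓝 (1 : G), B ⊆ V ∧ ∀ b ∈ B, ∀ g : G, g * b * g⁻¹ ∈ B := by
  obtain ⟨d, hd, hl, hr⟩ := h
  subst hd
  obtain ⟨r, hr0, hrV⟩ := Metric.mem_nhds_iff.1 hV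
  refine ⟨Metric.ball 1 r, Metric.ball_mem_nhds _ hr0, hrV, fun b hb g => ?_⟩
  rw [Metric.mem_ball] at hb ⊢
  have h1 : dist (g * b * g⁻¹) (g * 1 * g⁻¹) = dist b 1 := by rw [hr, hl]
  rw [mul_one, mul_inv_cancel] at h1
  rwa [h1]

theorem hasOpenNormalBasis_of_isTSI [FirstCountableTopology G] (h : IsTSI G)
    (hn : NonarchimedeanGroup G) : HasOpenNormalBasis G := by
  refine hasOpenNormalBasis_of_normalClosure fun V hV => ?_
  obtain ⟨H, hH⟩ := hn.is_nonarchimedean V hV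
  obtain ⟨B, hB, hBH, hconj⟩ := h.exists_conj_invariant_subset (H.isOpen.mem_nhds H.one_mem)
  refine ⟨B, hB, fun x hx => hH ?_⟩
  have : Group.conjugatesOfSet B ⊆ B := by
    intro y hy
    obtain ⟨b, hb, hby⟩ := Group.mem_conjugatesOfSet_iff.1 hy
    obtain ⟨g, rfl⟩ := isConj_iff.1 hby
    exact hconj b hb g
  have h2 : Subgroup.normalClosure B ≤ (H : Subgroup G) :=
    (Subgroup.closure_le _).2 (this.trans hBH)
  exact h2 hx

theorem HasOpenNormalBasis.nonarchimedeanGroup (h : HasOpenNormalBasis G) :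
    NonarchimedeanGroup G := by
  obtain ⟨N, -, -, hopen, hbasis⟩ := h
  refine ⟨fun U hU => ?_⟩
  obtain ⟨k, hk⟩ := hbasis U hU
  exact ⟨⟨N k, hopen k⟩, hk⟩

/-- The first-difference distance depends only on the set of coordinates where two points agree.
This makes translations acting on cosets isometries. -/
theorem PiNat.dist_congr {E E' : ℕ → Type*} {x y : ∀ n, E n} {x' y' : ∀ n, E' n}
    (h : ∀ n, x n = y n ↔ x' n = y' n) :
    (PiNat.dist (E := E)).dist x y = (PiNat.dist (E := E')).dist x' y' := by
  classical
  have hxy : x = y ↔ x' = y' := by simp only [funext_iff, h]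
  have hmem : ∀ m, y ∈ PiNat.cylinder x m ↔ y' ∈ PiNat.cylinder x' m := by
    intro m
    simp only [PiNat.mem_cylinder_iff]
    exact forall₂_congr fun n _ => by rw [eq_comm, h, eq_comm]
  by_cases hne : x = y
  · rw [hne, hxy.1 hne, PiNat.dist_self, PiNat.dist_self]
  · have hne' : x' ≠ y' := fun e => hne (hxy.2 e)
    rw [PiNat.dist_eq_of_ne hne, PiNat.dist_eq_of_ne hne']
    congr 1
    refine le_antisymm ?_ ?_
    · rw [← PiNat.mem_cylinder_iff_le_firstDiff hne', PiNat.mem_cylinder_comm, ← hmem,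
        PiNat.mem_cylinder_comm, PiNat.mem_cylinder_iff_le_firstDiff hne]
    · rw [← PiNat.mem_cylinder_iff_le_firstDiff hne, PiNat.mem_cylinder_comm, hmem,
        PiNat.mem_cylinder_comm, PiNat.mem_cylinder_iff_le_firstDiff hne']

theorem HasOpenNormalBasis.isTSI [T1Space G] (h : HasOpenNormalBasis G) : IsTSI G := by
  obtain ⟨N, -, hnormal, hopen, hbasis⟩ := h
  have hdisc : ∀ k, DiscreteTopology (G ⧸ N k) := fun k => QuotientGroup.discreteTopology (hopen k)
  let f : G → ∀ k, G ⧸ N k := fun g k => (g : G ⧸ N k)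
  have hfeq : ∀ g h k, f g k = f h k ↔ g⁻¹ * h ∈ N k := fun g h k => QuotientGroup.eq
  have hinj : Function.Injective f := by
    intro g h hgh
    by_contra hne
    have hne' : (1 : G) ≠ g⁻¹ * h := fun e => hne (by rw [eq_comm, inv_mul_eq_one] at e; exact e)
    obtain ⟨k, hk⟩ := hbasis {g⁻¹ * h}ᶜ (isOpen_compl_singleton.mem_nhds hne')
    exact hk ((hfeq g h k).1 (congrFun hgh k)) rfl
  have hind : IsInducing f := by
    refine isInducing_iff_nhds.2 fun g => le_antisymm ?_ ?_
    · refine Tendsto.le_comap (Continuous.tendsto ?_ g)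
      exact continuous_pi fun k => continuous_quot_mk
    · intro V hV
      have hV' : (fun x => g * x) ⁻¹' V ∈ 𝓝 (1 : G) :=
        (continuous_const_mul g).continuousAt.preimage_mem_nhds (by simpa using hV)
      obtain ⟨k, hk⟩ := hbasis _ hV'
      refine mem_comap.2 ⟨{z | z k = f g k}, ?_, fun x hx => ?_⟩
      · exact (continuous_apply k).continuousAt.preimage_mem_nhds
          ((isOpen_discrete {f g k}).mem_nhds rfl)
      · have := hk ((hfeq g x k).1 (Eq.symm hx))
        simpa using this
  let M : MetricSpace (∀ k, G ⧸ N k) := PiNat.metricSpace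
  refine ⟨MetricSpace.induced f hinj M, hind.eq_induced.symm, fun g h k => ?_, fun g h k => ?_⟩
  · refine PiNat.dist_congr fun n => ?_
    rw [hfeq, hfeq]
    simp [mul_assoc]
  · refine PiNat.dist_congr fun n => ?_
    rw [hfeq, hfeq]
    -- Right invariance is where normality enters; left invariance holds for any left cosets.
    have := (hnormal n).mem_comm_iff (a := g⁻¹ * (h⁻¹ * k)) (b := g)
    simpa [mul_assoc] using this

theorem hasOpenNormalBasis_iff [FirstCountableTopology G] [T1Space G] :
    HasOpenNormalBasis G ↔ IsTSI G ∧ NonarchimedeanGroup G :=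
  ⟨fun h => ⟨h.isTSI, h.nonarchimedeanGroup⟩, fun h => hasOpenNormalBasis_of_isTSI h.1 h.2⟩

end NormalBasis

/-! ### Reductions between E₀^ω, ℝ^ω/c₀ and E(G). -/

section Reductions

theorem Continuous.measurable_borel {X Y : Type*} [TopologicalSpace X] [TopologicalSpace Y]
    {f : X → Y} (hf : Continuous f) : @Measurable X Y (borel X) (borel Y) f := by
  let _ := borel X
  let _ := borel Y
  have : BorelSpace X := ⟨rfl⟩
  have : BorelSpace Y := ⟨rfl⟩
  exact hf.measurable

theorem BorelReducible.trans {X Y Z : Type*} [TopologicalSpace X] [TopologicalSpace Y]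
    [TopologicalSpace Z] {E : Setoid X} {F : Setoid Y} {H : Setoid Z} (h₁ : BorelReducible E F)
    (h₂ : BorelReducible F H) : BorelReducible E H := by
  obtain ⟨f, hf, hf'⟩ := h₁
  obtain ⟨g, hg, hg'⟩ := h₂
  exact ⟨g ∘ f, @Measurable.comp _ _ _ (borel X) (borel Y) (borel Z) _ _ hg hf,
    fun x y => (hf' x y).trans (hg' _ _)⟩

theorem eqvE0_iff {x y : ℕ → Bool} : eqvE0 x y ↔ ∀ᶠ n in atTop, x n = y n := by
  rw [eventually_atTop]
  exact ⟨fun ⟨m, h⟩ => ⟨m + 1, fun n hn => h n hn⟩, fun ⟨m, h⟩ => ⟨m, fun n hn => h n hn.le⟩⟩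

theorem eventually_unpair_fst_lt {P : ℕ → Prop} {K : ℕ}
    (h : ∀ k < K, ∀ᶠ m in atTop, P (Nat.pair k m)) :
    ∀ᶠ p in atTop, (Nat.unpair p).1 < K → P p := by
  rw [← Nat.cofinite_eq_atTop] at h ⊢
  rw [eventually_cofinite]
  have hfin : (⋃ k ∈ Set.Iio K, Nat.pair k '' {m | ¬ P (Nat.pair k m)}).Finite :=
    (Set.finite_Iio K).biUnion fun k hk => (eventually_cofinite.1 (h k hk)).image _
  refine hfin.subset fun p hp => ?_
  simp only [Set.mem_ofPred_eq, Classical.not_imp] at hp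
  refine Set.mem_biUnion hp.1 ⟨(Nat.unpair p).2, ?_, Nat.pair_unpair p⟩
  simpa [Nat.pair_unpair] using hp.2

theorem tendsto_pair_atTop (k : ℕ) : Tendsto (Nat.pair k) atTop atTop :=
  tendsto_atTop_mono (fun m => Nat.right_le_pair k m) tendsto_id

/-- With column k weighted by 2⁻ᵏ, late columns are uniformly small, while in a fixed column a
differing bit always costs exactly 2⁻ᵏ. -/
theorem eqvOmega_eqvE0_borelReducible_eqvRc0 :
    BorelReducible (eqvOmega eqvE0) eqvRc0 := by
  let f : (ℕ → ℕ → Bool) → ℕ → ℝ := fun x p =>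
    (1 / 2 : ℝ) ^ (Nat.unpair p).1 * (if x (Nat.unpair p).1 (Nat.unpair p).2 then 1 else 0)
  refine ⟨f, Continuous.measurable_borel ?_, fun x y => ?_⟩
  · refine continuous_pi fun p => continuous_const.mul ?_
    exact (continuous_of_discreteTopology (f := fun b : Bool => if b then (1 : ℝ) else 0)).comp
      ((continuous_apply _).comp (continuous_apply _))
  · change (∀ k, eqvE0 (x k) (y k)) ↔ Tendsto (fun p => f x p - f y p) atTop (𝓝 0)
    simp_rw [eqvE0_iff]
    have hle : ∀ p, |f x p - f y p| ≤ (1 / 2 : ℝ) ^ (Nat.unpair p).1 := by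
      intro p
      simp only [f, ← mul_sub, abs_mul, abs_pow]
      rw [abs_of_pos (by norm_num : (0 : ℝ) < 1 / 2)]
      refine mul_le_of_le_one_right (by positivity) ?_
      split_ifs <;> norm_num
    constructor
    · intro h
      rw [Metric.tendsto_nhds]
      intro ε hε
      obtain ⟨K, hK⟩ := exists_pow_lt_of_lt_one hε (by norm_num : (1 / 2 : ℝ) < 1)
      have h1 := eventually_unpair_fst_lt (P := fun p => f x p = f y p) (K := K) fun k _ => by
        filter_upwards [h k] with m hm
        simp [f, hm]
      filter_upwards [h1] with p hp
      rw [Real.dist_eq, sub_zero]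
      by_cases hpK : (Nat.unpair p).1 < K
      · rw [hp hpK]
        simpa using hε
      · refine (hle p).trans_lt (lt_of_le_of_lt ?_ hK)
        exact pow_le_pow_of_le_one (by norm_num) (by norm_num) (not_lt.1 hpK)
    · intro h k
      have h1 := (Metric.tendsto_nhds.1 (h.comp (tendsto_pair_atTop k))) ((1 / 2) ^ k)
        (by positivity)
      filter_upwards [h1] with m hm
      by_contra hne
      refine absurd hm (not_lt.2 (le_of_eq ?_))
      simp only [f, Function.comp_apply, Nat.unpair_pair, Real.dist_eq, sub_zero, ← mul_sub,
        abs_mul, abs_pow]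
      cases hx : x k m <;> cases hy : y k m <;> simp_all

variable {G : Type*} [Group G] [TopologicalSpace G] [IsTopologicalGroup G]

/-- Completeness of G for the N_k-uniformity. The complete metric need not be invariant, so Baire
category supplies one g for which w(n)g is Cauchy in it; translating back gives the limit. -/
theorem exists_tendsto_of_eventually_mul_inv_mem [PolishSpace G] {N : ℕ → Subgroup G}
    (hanti : Antitone N) (hnormal : ∀ k, (N k).Normal) (hopen : ∀ k, IsOpen (N k : Set G))
    (hbasis : ∀ V ∈ 𝓝 (1 : G), ∃ k, (N k : Set G) ⊆ V) {w : ℕ → G}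
    (hw : ∀ k, ∃ M, ∀ n ≥ M, w n * (w M)⁻¹ ∈ N k) : ∃ g, Tendsto w atTop (𝓝 g) := by
  let _ := TopologicalSpace.upgradeIsCompletelyMetrizable G
  let A : ℕ → Set G := fun m =>
    ⋃ M, interior {h | ∀ n ≥ M, dist (w n * h) (w M * h) ≤ 1 / (m + 1 : ℝ)}
  have hA : Dense (⋂ m, A m) := by
    refine dense_iInter_of_isOpen (fun m => isOpen_iUnion fun M => isOpen_interior) fun m => ?_
    refine dense_iff_inter_open.2 fun U hU ⟨g, hg⟩ => ?_
    obtain ⟨k, hk⟩ := hbasis ((fun a => a * g) ⁻¹' U)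
      ((continuous_mul_const g).continuousAt.preimage_mem_nhds (by simpa using hU.mem_nhds hg))
    obtain ⟨M, hM⟩ := hw k
    obtain ⟨l', hl'⟩ := hbasis ((fun a => a * (w M * g)) ⁻¹' Metric.ball (w M * g) (1 / (m + 1) / 2))
      ((continuous_mul_const _).continuousAt.preimage_mem_nhds
        (by simpa using Metric.ball_mem_nhds _ (by positivity)))
    let l := max k l'
    obtain ⟨M', hM'⟩ := hw l
    let M'' := max M M'
    have hM'' : ∀ n ≥ M'', w n * (w M'')⁻¹ ∈ N l := by
      intro n hn
      have h1 := hM' n ((le_max_right _ _).trans hn)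
      have h2 := hM' M'' (le_max_right _ _)
      have h3 := (N l).mul_mem h1 ((N l).inv_mem h2)
      simpa [mul_assoc] using h3
    have hball : ∀ a ∈ N l, dist (a * (w M * g)) (w M * g) < 1 / (m + 1) / 2 := fun a ha =>
      hl' (hanti (le_max_right k l') ha)
    -- This point h stays in U by normality, and w(n)h lies in N_l·(w(M)g), a small set, for all n ≥
    -- M''.
    refine ⟨(w M'')⁻¹ * w M * g, hk (?_ : (w M'')⁻¹ * w M ∈ N k), Set.mem_iUnion.2 ⟨M'', ?_⟩⟩
    · have h1 := (hnormal k).conj_mem _ ((N k).inv_mem (hM M'' (le_max_left _ _))) (w M'')⁻¹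
      simpa [mul_assoc] using h1
    · refine mem_interior_iff_mem_nhds.2 ?_
      have hnhds : (fun h => h * ((w M'')⁻¹ * w M * g)⁻¹) ⁻¹' (N l : Set G) ∈
          𝓝 ((w M'')⁻¹ * w M * g) :=
        (continuous_mul_const _).continuousAt.preimage_mem_nhds
          (by simpa using (hopen l).mem_nhds (N l).one_mem)
      refine mem_of_superset hnhds fun h hh n hn => ?_
      have key : ∀ n ≥ M'', dist (w n * h) (w M * g) < 1 / (m + 1) / 2 := by
        intro n hn
        have h1 : w n * (h * ((w M'')⁻¹ * w M * g)⁻¹) * (w n)⁻¹ * (w n * (w M'')⁻¹) ∈ N l :=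
          (N l).mul_mem ((hnormal l).conj_mem _ hh (w n)) (hM'' n hn)
        have h2 := hball _ h1
        have h3 : w n * (h * ((w M'')⁻¹ * w M * g)⁻¹) * (w n)⁻¹ * (w n * (w M'')⁻¹) * (w M * g) =
            w n * h := by group
        rwa [h3] at h2
      have := dist_triangle_right (w n * h) (w M'' * h) (w M * g)
      have h1 := key n hn
      have h2 := key M'' le_rfl
      linarith
  obtain ⟨g, hg⟩ := hA.nonempty
  have hcau : CauchySeq fun n => w n * g := by
    refine Metric.cauchySeq_iff'.2 fun ε hε => ?_
    obtain ⟨m, hm⟩ := exists_nat_one_div_lt hε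
    obtain ⟨M, hM⟩ := Set.mem_iUnion.1 (Set.mem_iInter.1 hg m)
    exact ⟨M, fun n hn => (interior_subset hM n hn).trans_lt hm⟩
  obtain ⟨a, ha⟩ := cauchySeq_tendsto_of_complete hcau
  exact ⟨a * g⁻¹, by simpa using ha.mul_const g⁻¹⟩

theorem HasOpenNormalBasis.borelReducible_eqvOmega_eqvE0 [PolishSpace G]
    (h : HasOpenNormalBasis G) : BorelReducible (eqvGroup G) (eqvOmega eqvE0) := by
  classical
  obtain ⟨N, hanti, hnormal, hopen, hbasis⟩ := h
  have hdisc : ∀ k, DiscreteTopology (G ⧸ N k) := fun k => QuotientGroup.discreteTopology (hopen k)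
  have hcount : ∀ k, Countable (G ⧸ N k) := fun k =>
    TopologicalSpace.separableSpace_iff_countable.1 inferInstance
  choose c hc using fun k => exists_injective_nat (G ⧸ N k)
  -- Increments in this order separate x from y: conjugating by x(n) turns equality of cosets into
  -- constancy of x(n)y(n)⁻¹ modulo N_k from n to n+1.
  let q : ∀ k, (ℕ → G) → ℕ → G ⧸ N k := fun k x n => ((x (n + 1))⁻¹ * x n : G)
  -- The indicator of the graph of the coded sequence: changing one value alters at most two bits.
  let f : (ℕ → G) → ℕ → ℕ → Bool := fun x k p =>
    decide (c k (q k x (Nat.unpair p).1) = (Nat.unpair p).2)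
  have hqf : ∀ k x y, (∀ᶠ n in atTop, q k x n = q k y n) ↔ ∀ᶠ p in atTop, f x k p = f y k p := by
    intro k x y
    constructor
    · intro hq
      rw [← Nat.cofinite_eq_atTop, eventually_cofinite] at hq ⊢
      have hfin : (⋃ n ∈ {n | ¬ q k x n = q k y n},
          {Nat.pair n (c k (q k x n)), Nat.pair n (c k (q k y n))}).Finite :=
        hq.biUnion fun n _ => Set.toFinite _
      refine hfin.subset fun p hp => ?_
      by_cases hqe : q k x (Nat.unpair p).1 = q k y (Nat.unpair p).1
      · exact absurd (by simp only [f, hqe]) hp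
      refine Set.mem_biUnion hqe ?_
      by_cases hx : c k (q k x (Nat.unpair p).1) = (Nat.unpair p).2
      · exact Or.inl (by rw [hx, Nat.pair_unpair])
      · by_cases hy : c k (q k y (Nat.unpair p).1) = (Nat.unpair p).2
        · exact Or.inr (by rw [hy, Nat.pair_unpair]; rfl)
        · exact absurd (by simp only [f, hx, hy]) hp
    · intro hf
      have h1 : Tendsto (fun n => Nat.pair n (c k (q k x n))) atTop atTop :=
        tendsto_atTop_mono (fun n => Nat.left_le_pair n _) tendsto_id
      filter_upwards [h1.eventually hf] with n hn
      simp only [f, Nat.unpair_pair] at hn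
      have h2 : c k (q k y n) = c k (q k x n) := by simpa using hn
      exact (hc k h2).symm
  have hq : ∀ k x y n, q k x n = q k y n ↔
      (x (n + 1) * (y (n + 1))⁻¹) * (x n * (y n)⁻¹)⁻¹ ∈ N k := by
    intro k x y n
    rw [show (q k x n = q k y n) ↔ _ from QuotientGroup.eq]
    have h1 := (hnormal k).mem_comm_iff (a := x (n + 1) * (y (n + 1))⁻¹ * y n) (b := (x n)⁻¹)
    simp only [mul_inv_rev, inv_inv, mul_assoc] at h1 ⊢
    exact h1.symm
  refine ⟨f, Continuous.measurable_borel ?_, fun x y => ?_⟩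
  · refine continuous_pi fun k => continuous_pi fun p => ?_
    refine (continuous_of_discreteTopology
      (f := fun z : G ⧸ N k => decide (c k z = (Nat.unpair p).2))).comp ?_
    exact continuous_quot_mk.comp
      ((continuous_apply _).inv.mul (continuous_apply (Nat.unpair p).1))
  · change (∃ g, Tendsto (fun n => x n * (y n)⁻¹) atTop (𝓝 g)) ↔ ∀ k, eqvE0 (f x k) (f y k)
    simp_rw [eqvE0_iff, ← hqf, hq]
    constructor
    · rintro ⟨g, hg⟩ k
      have h1 : Tendsto (fun n => (x (n + 1) * (y (n + 1))⁻¹) * (x n * (y n)⁻¹)⁻¹) atTop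
          (𝓝 (g * g⁻¹)) := (hg.comp (tendsto_add_atTop_nat 1)).mul hg.inv
      rw [mul_inv_cancel] at h1
      exact h1.eventually ((hopen k).mem_nhds (N k).one_mem)
    · intro h
      refine exists_tendsto_of_eventually_mul_inv_mem hanti hnormal hopen hbasis fun k => ?_
      obtain ⟨M, hM⟩ := eventually_atTop.1 (h k)
      refine ⟨M, fun n hn => ?_⟩
      induction n, hn using Nat.le_induction with
      | base => simp
      | succ n hn ih =>
        have h1 := (N k).mul_mem (hM n hn) ih
        rwa [← mul_assoc, inv_mul_cancel_right] at h1

theorem HasOpenNormalBasis.eqvOmega_eqvE0_borelReducible [PolishSpace G] [Uncountable G]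
    (h : HasOpenNormalBasis G) : BorelReducible (eqvOmega eqvE0) (eqvGroup G) := by
  classical
  obtain ⟨N, hanti, -, hopen, hbasis⟩ := h
  have hg : ∀ k, ∃ g ∈ N k, g ≠ 1 := by
    intro k
    by_contra! hk
    have h1 : IsOpen ({1} : Set G) := by
      convert hopen k
      ext x
      exact ⟨fun hx => by rw [hx]; exact (N k).one_mem, fun hx => hk x hx⟩
    have := discreteTopology_of_isOpen_singleton_one h1
    have hc : Countable G := TopologicalSpace.separableSpace_iff_countable.1 inferInstance
    exact not_countable hc
  choose g hgN hg1 using hg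
  let e : (ℕ → ℕ → Bool) → ℕ → G := fun x p =>
    if x (Nat.unpair p).1 (Nat.unpair p).2 then g (Nat.unpair p).1 else 1
  -- The interleaved 1's force any limit of the quotients to be 1.
  let f : (ℕ → ℕ → Bool) → ℕ → G := fun x n => if n % 2 = 0 then 1 else e x (n / 2)
  have hf0 : ∀ x p, f x (2 * p) = 1 := fun x p => by simp [f]
  have hf1 : ∀ x p, f x (2 * p + 1) = e x p := fun x p => by
    simp [f, Nat.add_mod, show (2 * p + 1) / 2 = p by omega]
  have ht0 : Tendsto (fun p : ℕ => 2 * p) atTop atTop :=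
    tendsto_atTop_mono (fun p => by dsimp; omega) tendsto_id
  have ht1 : Tendsto (fun p : ℕ => 2 * p + 1) atTop atTop :=
    tendsto_atTop_mono (fun p => by dsimp; omega) tendsto_id
  refine ⟨f, Continuous.measurable_borel ?_, fun x y => ?_⟩
  · refine continuous_pi fun n => ?_
    by_cases hn : n % 2 = 0
    · simp only [f, hn, if_true]
      exact continuous_const
    · simp only [f, hn, if_false]
      exact (continuous_of_discreteTopology
        (f := fun b : Bool => if b then g (Nat.unpair (n / 2)).1 else 1)).comp
        ((continuous_apply _).comp (continuous_apply _))
  · change (∀ k, eqvE0 (x k) (y k)) ↔ ∃ a, Tendsto (fun n => f x n * (f y n)⁻¹) atTop (𝓝 a)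
    simp_rw [eqvE0_iff]
    constructor
    · intro hxy
      refine ⟨1, fun V hV => ?_⟩
      obtain ⟨K, hK⟩ := hbasis V hV
      have h1 := eventually_unpair_fst_lt (P := fun p => e x p = e y p) (K := K) fun k _ => by
        filter_upwards [hxy k] with m hm
        simp [e, hm]
      have h2 : ∀ p, e x p ∈ N (Nat.unpair p).1 := fun p => by
        simp only [e]
        split_ifs
        exacts [hgN _, one_mem _]
      have h2' : ∀ p, e y p ∈ N (Nat.unpair p).1 := fun p => by
        simp only [e]
        split_ifs
        exacts [hgN _, one_mem _]
      obtain ⟨P, hP⟩ := eventually_atTop.1 h1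
      refine eventually_atTop.2 ⟨2 * P, fun n hn => hK ?_⟩
      obtain ⟨p, rfl | rfl⟩ := Nat.even_or_odd' n
      · simp [hf0, one_mem]
      · change f x (2 * p + 1) * (f y (2 * p + 1))⁻¹ ∈ N K
        rw [hf1, hf1]
        by_cases hpK : (Nat.unpair p).1 < K
        · rw [hP p (by omega) hpK, mul_inv_cancel]
          exact one_mem _
        · exact hanti (not_lt.1 hpK) (mul_mem (h2 p) (inv_mem (h2' p)))
    · rintro ⟨a, ha⟩ k
      have ha1 : a = 1 := by
        refine tendsto_nhds_unique (ha.comp ht0) ?_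
        simp [Function.comp_def, hf0]
      subst ha1
      have h1 := (ha.comp ht1).comp (tendsto_pair_atTop k)
      have hV : ({g k, (g k)⁻¹}ᶜ : Set G) ∈ 𝓝 (1 : G) := by
        refine (Set.toFinite _).isClosed.isOpen_compl.mem_nhds ?_
        have := hg1 k
        simp only [Set.mem_compl_iff, Set.mem_insert_iff, Set.mem_singleton_iff, not_or]
        exact ⟨this.symm, fun h => this (inv_eq_one.1 h.symm)⟩
      filter_upwards [h1.eventually hV] with m hm
      simp only [Function.comp_apply, hf1, e, Nat.unpair_pair] at hm
      cases hx : x k m <;> cases hy : y k m <;> simp_all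

end Reductions

/-! ### Fusion and Baire category tools. -/

section Fusion

theorem exists_agree_subset_of_mem_nhds {Λ : Type*} [TopologicalSpace Λ] [DiscreteTopology Λ]
    {z : ℕ → Λ} {U : Set (ℕ → Λ)} (hU : U ∈ 𝓝 z) :
    ∃ N, ∀ w : ℕ → Λ, (∀ i < N, w i = z i) → w ∈ U := by
  rw [nhds_pi, Filter.mem_pi] at hU
  obtain ⟨I, hI, t, ht, htU⟩ := hU
  obtain ⟨N, hN⟩ := hI.bddAbove
  refine ⟨N + 1, fun w hw => htU fun i hi => ?_⟩
  rw [hw i (Nat.lt_succ_of_le (hN hi))]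
  exact mem_of_mem_nhds (ht i)

/-- A sequence of states whose points change only ever later converges to a point of a
countable intersection of open sets, retaining the locally satisfied conditions. -/
theorem exists_fusion {Λ S : Type*} {O : ℕ → Set (ℕ → Λ)} (z : S → ℕ → Λ)
    (R : ℕ → S → S → Prop) (good : ℕ → S → (ℕ → Λ) → Prop)
    (hO : ∀ k s, ∃ N, ∀ w : ℕ → Λ, (∀ i < N, w i = z s i) → w ∈ O k)
    (hgood : ∀ k s, ∃ N, ∀ w ∈ ⋂ k, O k, (∀ i < N, w i = z s i) → good k s w)
    (hstep : ∀ k s N, ∃ s', R k s s' ∧ ∀ i < N, z s' i = z s i) (s₀ : S) :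
    ∃ (s : ℕ → S) (N : ℕ → ℕ) (y : ℕ → Λ), s 0 = s₀ ∧ (∀ k, R k (s k) (s (k + 1))) ∧
      y ∈ ⋂ k, O k ∧ (∀ k, good k (s k) y) ∧ (∀ k, k ≤ N k) ∧
      ∀ k, ∀ i < N k, y i = z (s k) i := by
  choose a ha using hO
  choose b hb using hgood
  choose c hcR hc using hstep
  let p : ℕ → S × ℕ := fun k => Nat.rec (s₀, max (a 0 s₀) (b 0 s₀)) (fun k q =>
    (c k q.1 q.2, max (q.2 + 1) (max (a (k + 1) (c k q.1 q.2)) (b (k + 1) (c k q.1 q.2))))) k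
  have hsucc : ∀ k, (p (k + 1)).1 = c k (p k).1 (p k).2 := fun k => rfl
  have hN : ∀ k, (p k).2 < (p (k + 1)).2 := fun k => Nat.lt_of_succ_le (le_max_left _ _)
  have hmono : StrictMono fun k => (p k).2 := strictMono_nat_of_lt_succ hN
  have ha' : ∀ k, a k (p k).1 ≤ (p k).2 := by
    rintro (_ | k)
    · exact le_max_left _ _
    · exact (le_max_left _ _).trans (le_max_right _ _)
  have hb' : ∀ k, b k (p k).1 ≤ (p k).2 := by
    rintro (_ | k)
    · exact le_max_right _ _
    · exact (le_max_right _ _).trans (le_max_right _ _)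
  have hagree : ∀ k l, k ≤ l → ∀ i < (p k).2, z (p l).1 i = z (p k).1 i := by
    intro k l hkl
    induction l, hkl using Nat.le_induction with
    | base => exact fun i _ => rfl
    | succ l hl ih =>
      intro i hi
      rw [← ih i hi, hsucc]
      exact hc _ _ _ i (hi.trans_le (hmono.monotone hl))
  have hid : ∀ k, k ≤ (p k).2 := fun k => hmono.le_apply
  -- Stage i + 1 has threshold at least i + 1, so coordinate i is already frozen there.
  let y : ℕ → Λ := fun i => z (p (i + 1)).1 i
  have hy : ∀ k, ∀ i < (p k).2, y i = z (p k).1 i := by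
    intro k i hi
    rcases le_total k (i + 1) with h | h
    · exact hagree k (i + 1) h i hi
    · exact (hagree (i + 1) k h i (hid (i + 1))).symm
  have hyO : y ∈ ⋂ k, O k :=
    Set.mem_iInter.2 fun k => ha k _ y fun i hi => hy k i (hi.trans_le (ha' k))
  exact ⟨fun k => (p k).1, fun k => (p k).2, y, rfl, fun k => hcR _ _ _, hyO,
    fun k => hb k _ y hyO fun i hi => hy k i (hi.trans_le (hb' k)), hid, hy⟩

/-- Each Borel set equals an open set modulo a meager set; countably many exceptional sets are
discarded at once. -/
theorem exists_open_dense_seq_isOpen_inter {X ι : Type*} [TopologicalSpace X] [MeasurableSpace X]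
    [BorelSpace X] [Countable ι] {A : ι → Set X} (hA : ∀ i, MeasurableSet (A i)) :
    ∃ O : ℕ → Set X, (∀ n, IsOpen (O n)) ∧ (∀ n, Dense (O n)) ∧
      ∀ i, ∀ z ∈ ⋂ n, O n, z ∈ A i → ∃ W ∈ 𝓝 z, ∀ w ∈ ⋂ n, O n, w ∈ W → w ∈ A i := by
  choose W hW hAW using fun i => (hA i).residualEq_isOpen
  have hres : {z | ∀ i, z ∈ A i ↔ z ∈ W i} ∈ residual X :=
    (eventually_countable_forall (l := residual X)).2 fun i => (hAW i).mem_iff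
  obtain ⟨S, hSo, hSd, hSc, hS⟩ := mem_residual_iff.1 hres
  obtain ⟨O, hO⟩ := (hSc.insert Set.univ).exists_eq_range (Set.insert_nonempty _ _)
  have hmem : ∀ n, O n = Set.univ ∨ O n ∈ S := fun n => by
    have : O n ∈ insert Set.univ S := hO ▸ Set.mem_range_self n
    exact this
  have hsub : ∀ z ∈ ⋂ n, O n, ∀ i, z ∈ A i ↔ z ∈ W i := by
    intro z hz
    refine hS (Set.mem_sInter.2 fun t ht => ?_)
    obtain ⟨n, rfl⟩ := hO ▸ Set.mem_insert_of_mem Set.univ ht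
    exact Set.mem_iInter.1 hz n
  refine ⟨O, fun n => ?_, fun n => ?_, fun i z hz hzA => ⟨W i, ?_, fun w hw hwW => ?_⟩⟩
  · rcases hmem n with h | h
    · rw [h]; exact isOpen_univ
    · exact hSo _ h
  · rcases hmem n with h | h
    · rw [h]; exact dense_univ
    · exact hSd _ h
  · exact (hW i).mem_nhds ((hsub z hz i).1 hzA)
  · exact (hsub w hw i).2 hwW

theorem exists_forall_apply_mem_iInter {X Γ : Type*} [TopologicalSpace X] [BaireSpace X]
    [Nonempty X] [Countable Γ] (h : Γ → X ≃ₜ X) {O : ℕ → Set X} (ho : ∀ n, IsOpen (O n))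
    (hd : ∀ n, Dense (O n)) : ∃ x, ∀ γ, h γ x ∈ ⋂ n, O n := by
  have := dense_iInter_of_isOpen (f := fun p : Γ × ℕ => h p.1 ⁻¹' O p.2)
    (fun p => (ho p.2).preimage (h p.1).continuous)
    (fun p => (hd p.2).preimage (h p.1).isOpenMap)
  obtain ⟨x, hx⟩ := this.nonempty
  exact ⟨x, fun γ => Set.mem_iInter.2 fun n => Set.mem_iInter.1 hx (γ, n)⟩

end Fusion

/-! ### Countable groups: E₀^ω does not reduce to a countable union of closed sets. -/

section Countable

/-- A dichotomy at a generic x. If finite modifications can always leave K m without touching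
columns up to m, fusing them gives a point equivalent to x outside every K m. Otherwise some K m
traps all modifications in later columns, and infinitely many changes in column m + 1 stay in K m by
closedness. -/
theorem not_borelReducible_eqvOmega_eqvE0_of_isClosed {Y : Type*} [TopologicalSpace Y]
    [SecondCountableTopology Y] {F : Setoid Y} {K : ℕ → Set (Y × Y)} (hK : ∀ m, IsClosed (K m))
    (hF : ∀ a b, F a b ↔ ∃ m, (a, b) ∈ K m) : ¬ BorelReducible (eqvOmega eqvE0) F := by
  classical
  rintro ⟨f₀, hf₀, hf₀F⟩
  let f : (ℕ → Bool) → Y := fun w => f₀ fun k m => w (Nat.pair k m)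
  have hf : @Measurable _ _ (borel (ℕ → Bool)) (borel Y) f :=
    @Measurable.comp _ _ _ (borel (ℕ → Bool)) (borel (ℕ → ℕ → Bool)) (borel Y) _ _ hf₀
      (Continuous.measurable_borel (continuous_pi fun k => continuous_pi fun m =>
        continuous_apply _))
  have hfF : ∀ w w', F (f w) (f w') ↔
      ∀ k, ∀ᶠ m in atTop, w (Nat.pair k m) = w' (Nat.pair k m) := by
    intro w w'
    rw [← hf₀F]
    exact forall_congr' fun k => eqvE0_iff
  obtain ⟨b, hbc, -, hb⟩ := TopologicalSpace.exists_countable_basis Y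
  have : Countable b := hbc
  obtain ⟨O, hOo, hOd, hO⟩ : ∃ O : ℕ → Set (ℕ → Bool), (∀ n, IsOpen (O n)) ∧
      (∀ n, Dense (O n)) ∧ ∀ i : b, ∀ z ∈ ⋂ n, O n, z ∈ f ⁻¹' i.1 →
        ∃ W ∈ 𝓝 z, ∀ w ∈ ⋂ n, O n, w ∈ W → w ∈ f ⁻¹' i.1 := by
    let _ := borel (ℕ → Bool)
    have : BorelSpace (ℕ → Bool) := ⟨rfl⟩
    refine exists_open_dense_seq_isOpen_inter fun i => ?_
    exact hf (MeasurableSpace.measurableSet_generateFrom (hb.isOpen i.2))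
  have hcont : ∀ z ∈ ⋂ n, O n, ∀ V ∈ 𝓝 (f z), ∃ N, ∀ w ∈ ⋂ n, O n, (∀ i < N, w i = z i) →
      f w ∈ V := by
    intro z hz V hV
    obtain ⟨U, hU, hzU, hUV⟩ := hb.mem_nhds_iff.1 hV
    obtain ⟨W, hW, hWO⟩ := hO ⟨U, hU⟩ z hz hzU
    obtain ⟨N, hN⟩ := exists_agree_subset_of_mem_nhds hW
    exact ⟨N, fun w hw hwz => hUV (hWO w hw (hN w hwz))⟩
  let h : Finset ℕ → (ℕ → Bool) ≃ₜ (ℕ → Bool) := fun s =>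
    { toFun := fun z i => if i ∈ s then !z i else z i
      invFun := fun z i => if i ∈ s then !z i else z i
      left_inv := fun z => by ext i; by_cases hi : i ∈ s <;> simp [hi]
      right_inv := fun z => by ext i; by_cases hi : i ∈ s <;> simp [hi]
      continuous_toFun := continuous_pi fun i =>
        (continuous_of_discreteTopology (f := fun c : Bool => if i ∈ s then !c else c)).comp
          (continuous_apply i)
      continuous_invFun := continuous_pi fun i =>
        (continuous_of_discreteTopology (f := fun c : Bool => if i ∈ s then !c else c)).comp
          (continuous_apply i) }
  obtain ⟨x, hx⟩ := exists_forall_apply_mem_iInter h hOo hOd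
  have hQ : ∀ z : ℕ → Bool, (∀ᶠ i in atTop, z i = x i) → z ∈ ⋂ n, O n := by
    intro z hz
    rw [← Nat.cofinite_eq_atTop, eventually_cofinite] at hz
    convert hx hz.toFinset
    ext i
    by_cases hi : z i = x i
    · simp [h, hi]
    · simp [h, Bool.eq_not.2 hi]
  have hxC : x ∈ ⋂ n, O n := hQ x (Eventually.of_forall fun _ => rfl)
  have hleave : ∀ m, ∀ z ∈ ⋂ n, O n, (f x, f z) ∉ K m →
      ∃ N, ∀ w ∈ ⋂ n, O n, (∀ i < N, w i = z i) → (f x, f w) ∉ K m := by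
    intro m z hz hzK
    exact hcont z hz {a | (f x, a) ∉ K m}
      (((hK m).isOpen_compl.preimage (Continuous.prodMk_right (f x))).mem_nhds hzK)
  have hOagree : ∀ k : ℕ, ∀ z ∈ ⋂ n, O n, ∃ N, ∀ w : ℕ → Bool, (∀ i < N, w i = z i) → w ∈ O k :=
    fun k z hz => exists_agree_subset_of_mem_nhds ((hOo k).mem_nhds (Set.mem_iInter.1 hz k))
  by_cases hcase : ∀ m, ∀ z : ℕ → Bool, (∀ᶠ i in atTop, z i = x i) → ∀ N, ∃ z' : ℕ → Bool,
      (∀ᶠ i in atTop, z' i = x i) ∧ (∀ i < N, z' i = z i) ∧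
      (∀ i, (Nat.unpair i).1 ≤ m → z' i = z i) ∧ (f x, f z') ∉ K m
  · obtain ⟨s, N, y, -, hR, hyC, hgood, hN, hagree⟩ := exists_fusion (O := O)
      (S := {z : ℕ → Bool // ∀ᶠ i in atTop, z i = x i}) (fun s => s.1)
      (fun m s s' => (∀ i, (Nat.unpair i).1 ≤ m → s'.1 i = s.1 i) ∧ (f x, f s'.1) ∉ K m)
      -- Step k arranges avoidance of K k at state k + 1, hence the shift; the condition is vacuous
      -- when a state does not avoid the set, as may happen at the initial one.
      (fun k s y => (f x, f s.1) ∉ K (k - 1) → (f x, f y) ∉ K (k - 1))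
      (fun k s => hOagree k s.1 (hQ s.1 s.2))
      (fun k s => by
        by_cases hs : (f x, f s.1) ∈ K (k - 1)
        · exact ⟨0, fun w _ _ h => absurd hs h⟩
        · obtain ⟨N, hN⟩ := hleave _ _ (hQ s.1 s.2) hs
          exact ⟨N, fun w hw hws _ => hN w hw hws⟩)
      (fun m s N => by
        obtain ⟨z', h1, h2, h3, h4⟩ := hcase m s.1 s.2 N
        exact ⟨⟨z', h1⟩, ⟨h3, h4⟩, h2⟩)
      ⟨x, Eventually.of_forall fun _ => rfl⟩
    have hcol : ∀ c k, c ≤ k → ∀ m, (s k).1 (Nat.pair c m) = (s c).1 (Nat.pair c m) := by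
      intro c k hk m
      induction k, hk using Nat.le_induction with
      | base => rfl
      | succ k hk ih => rw [← ih, (hR k).1 _ (by simpa using hk)]
    have hxy : F (f x) (f y) := by
      refine (hfF x y).2 fun c => ?_
      filter_upwards [(tendsto_pair_atTop c).eventually (s c).2] with m hm
      rw [hagree (max c (Nat.pair c m + 1)) _
        ((Nat.lt_succ_self _).trans_le ((le_max_right _ _).trans (hN _))),
        hcol c _ (le_max_left _ _), hm]
    obtain ⟨m, hm⟩ := (hF _ _).1 hxy
    exact hgood (m + 1) (hR m).2 hm
  · push Not at hcase
    obtain ⟨m, z, hz, N₀, hstuck⟩ := hcase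
    obtain ⟨s, N, y, -, hR, hyC, hgood, hN, hagree⟩ := exists_fusion (O := O)
      (S := {z' : ℕ → Bool // (∀ᶠ i in atTop, z' i = x i) ∧ (∀ i < N₀, z' i = z i) ∧
        ∀ i, (Nat.unpair i).1 ≤ m → z' i = z i} × ℕ) (fun s => s.1.1)
      (fun k s s' => k ≤ s'.2 ∧ s'.1.1 (Nat.pair (m + 1) s'.2) ≠ x (Nat.pair (m + 1) s'.2))
      (fun k s y => y (Nat.pair (m + 1) s.2) = s.1.1 (Nat.pair (m + 1) s.2))
      (fun k s => hOagree k s.1.1 (hQ s.1.1 s.1.2.1))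
      (fun k s => ⟨Nat.pair (m + 1) s.2 + 1, fun w _ hw => hw _ (Nat.lt_succ_self _)⟩)
      (fun k s N => by
        let l := max k (max N₀ N)
        let i₀ := Nat.pair (m + 1) l
        have hl : l ≤ i₀ := Nat.right_le_pair _ _
        have hne : ∀ i, i ≠ i₀ → Function.update s.1.1 i₀ (!x i₀) i = s.1.1 i := fun i hi =>
          Function.update_of_ne hi _ _
        have hlN₀ : N₀ ≤ l := (le_max_left _ _).trans (le_max_right _ _)
        have hlN : N ≤ l := (le_max_right _ _).trans (le_max_right _ _)
        refine ⟨⟨⟨Function.update s.1.1 i₀ (!x i₀), ?_, fun i hi => ?_, fun i hi => ?_⟩, l⟩,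
          ⟨le_max_left _ _, ?_⟩, fun i hi => hne i (by omega)⟩
        · filter_upwards [s.1.2.1, eventually_gt_atTop i₀] with i hi hi'
          rw [hne i hi'.ne', hi]
        · rw [hne i (by omega), s.1.2.2.1 i hi]
        · rw [hne i, s.1.2.2.2 i hi]
          rintro rfl
          simp [i₀] at hi
        · simp [i₀])
      ⟨⟨z, hz, fun _ _ => rfl, fun _ _ => rfl⟩, 0⟩
    have hyK : (f x, f y) ∈ K m := by
      by_contra hyK
      obtain ⟨M, hM⟩ := hleave m y hyC hyK
      refine hM (s M).1.1 (hQ _ (s M).1.2.1)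
        (fun i hi => (hagree M i (hi.trans_le (hN M))).symm) ?_
      exact hstuck _ (s M).1.2.1 (s M).1.2.2.1 (s M).1.2.2.2
    obtain ⟨l, hl⟩ := eventually_atTop.1 ((hfF x y).1 ((hF _ _).2 ⟨m, hyK⟩) (m + 1))
    exact (hR l).2 ((hgood (l + 1)).symm.trans (hl _ (hR l).1).symm)

theorem discreteTopology_of_countable {G : Type*} [Group G] [TopologicalSpace G]
    [IsTopologicalGroup G] [PolishSpace G] [Countable G] : DiscreteTopology G := by
  have : BaireSpace G := by
    let _ := TopologicalSpace.upgradeIsCompletelyMetrizable G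
    infer_instance
  obtain ⟨g, hg⟩ := nonempty_interior_of_iUnion_of_closed (f := fun g : G => ({g} : Set G))
    (fun g => isClosed_singleton) (Set.iUnion_of_singleton G)
  have hg' : IsOpen ({g} : Set G) := by
    obtain ⟨a, ha⟩ := hg
    have : interior {g} = {g} :=
      subset_antisymm interior_subset (by
        have := interior_subset ha
        rw [Set.mem_singleton_iff] at this
        simpa [← this] using ha)
    exact this ▸ isOpen_interior
  refine discreteTopology_of_isOpen_singleton_one ?_
  convert hg'.preimage (continuous_const_mul g)
  ext a
  simp

theorem not_borelReducible_eqvGroup_of_countable {G : Type*} [Group G] [TopologicalSpace G]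
    [IsTopologicalGroup G] [PolishSpace G] [Countable G] :
    ¬ BorelReducible (eqvOmega eqvE0) (eqvGroup G) := by
  have := discreteTopology_of_countable (G := G)
  refine not_borelReducible_eqvOmega_eqvE0_of_isClosed
    (K := fun m => ⋂ n ≥ m, {p | p.1 n * (p.2 n)⁻¹ = p.1 m * (p.2 m)⁻¹}) (fun m => ?_)
    fun a b => ?_
  · exact isClosed_biInter fun n _ => isClosed_eq (by fun_prop) (by fun_prop)
  · change (∃ g, Tendsto (fun n => a n * (b n)⁻¹) atTop (𝓝 g)) ↔ _
    simp only [Set.mem_iInter]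
    constructor
    · rintro ⟨g, hg⟩
      rw [nhds_discrete, tendsto_pure, eventually_atTop] at hg
      obtain ⟨m, hm⟩ := hg
      exact ⟨m, fun n hn => (hm n hn).trans (hm m le_rfl).symm⟩
    · rintro ⟨m, hm⟩
      exact ⟨a m * (b m)⁻¹, tendsto_const_nhds.congr' (eventually_atTop.2 ⟨m, fun n hn =>
        (hm n hn).symm⟩)⟩

end Countable

/-! ### Eventually constant sequences, the countable group of translations. -/

section EvConst

/-- The sequence is eventually constant. -/
def EvConst {Λ : Type*} (β : ℕ → Λ) : Prop := ∃ m, ∀ᶠ i in atTop, β i = m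

/-- The sequence equal to `1` before time `N` and to `u` from then on. -/
def stepSeq {Λ : Type*} [One Λ] (N : ℕ) (u : Λ) : ℕ → Λ := fun i => if i < N then 1 else u

theorem stepSeq_of_lt {Λ : Type*} [One Λ] {N i : ℕ} (u : Λ) (h : i < N) : stepSeq N u i = 1 :=
  if_pos h

theorem stepSeq_of_le {Λ : Type*} [One Λ] {N i : ℕ} (u : Λ) (h : N ≤ i) : stepSeq N u i = u :=
  if_neg (not_lt.2 h)

theorem evConst_iff_getD {Λ : Type*} {β : ℕ → Λ} :
    EvConst β ↔ ∃ γ : List Λ × Λ, β = fun i => γ.1.getD i γ.2 := by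
  constructor
  · rintro ⟨m, hm⟩
    obtain ⟨N, hN⟩ := eventually_atTop.1 hm
    refine ⟨((List.range N).map β, m), funext fun i => ?_⟩
    rcases lt_or_ge i N with hi | hi
    · simp [List.getD, hi]
    · simp [List.getD, hi, hN i hi]
  · rintro ⟨γ, rfl⟩
    refine ⟨γ.2, eventually_atTop.2 ⟨γ.1.length, fun i hi => ?_⟩⟩
    exact List.getD_eq_default _ _ hi

theorem countable_evConst (Λ : Type*) [Countable Λ] : Countable {β : ℕ → Λ // EvConst β} := by
  have : Function.Surjective fun γ : List Λ × Λ =>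
      (⟨fun i => γ.1.getD i γ.2, evConst_iff_getD.2 ⟨γ, rfl⟩⟩ : {β : ℕ → Λ // EvConst β}) := by
    rintro ⟨β, hβ⟩
    obtain ⟨γ, hγ⟩ := evConst_iff_getD.1 hβ
    exact ⟨γ, Subtype.ext hγ.symm⟩
  exact this.countable

variable {Λ : Type*} [Group Λ] {β γ : ℕ → Λ}

theorem EvConst.mul (hβ : EvConst β) (hγ : EvConst γ) : EvConst (β * γ) := by
  obtain ⟨m, hm⟩ := hβ
  obtain ⟨n, hn⟩ := hγ
  exact ⟨m * n, by filter_upwards [hm, hn] with i h1 h2; rw [Pi.mul_apply, h1, h2]⟩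

theorem evConst_stepSeq (N : ℕ) (u : Λ) : EvConst (stepSeq N u) :=
  ⟨u, eventually_atTop.2 ⟨N, fun _ hi => stepSeq_of_le u hi⟩⟩

end EvConst

/-! ### Generic points for the estimates on the reduction. -/

section Generic

/-- `φ`-images of sequences are `E(G)`-equivalent exactly when the `θ`-values are
`ℝ^ω/c₀`-equivalent. -/
def ReducesVia {Λ G : Type*} [Group Λ] [Group G] [TopologicalSpace G] (φ : Λ →* G)
    (θ : (ℕ → Λ) → ℕ → ℝ) : Prop :=
  ∀ x y, (∃ g, Tendsto (fun n => φ (x n) * (φ (y n))⁻¹) atTop (𝓝 g)) ↔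
    Tendsto (fun n => θ x n - θ y n) atTop (𝓝 0)

/-- All late jumps by elements of `T` move the coordinates of `θ` past `J` by at most `ε`. -/
def SmallJumps {Λ G : Type*} [Group Λ] [Group G] (φ : Λ →* G) (θ : (ℕ → Λ) → ℕ → ℝ)
    (T : Set G) (ε : ℝ) (J N₀ : ℕ) (z : ℕ → Λ) : Prop :=
  ∀ N ≥ N₀, ∀ u, φ u ∈ T → ∀ j ≥ J, |θ (stepSeq N u * z) j - θ z j| ≤ ε

/-- A point whose eventually constant translates lie in a countable intersection of open sets on
which `θ` is continuous and certain estimates are open conditions. -/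
structure IsEstimateGeneric {Λ G : Type*} [Group Λ] [TopologicalSpace Λ] [Group G] (φ : Λ →* G)
    (θ : (ℕ → Λ) → ℕ → ℝ) (T : ℕ → Set G) (O : ℕ → Set (ℕ → Λ)) (x : ℕ → Λ) : Prop where
  isOpen : ∀ n, IsOpen (O n)
  mem : ∀ β, EvConst β → β * x ∈ ⋂ n, O n
  cont : ∀ z ∈ ⋂ n, O n, ∀ j, ∀ ε > 0, ∃ N, ∀ w ∈ ⋂ n, O n, (∀ i < N, w i = z i) →
    |θ w j - θ z j| ≤ ε
  mul : ∀ β, EvConst β → ∀ e J : ℕ, ∀ z ∈ ⋂ n, O n,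
    (∀ j ≥ J, |θ (β * z) j - θ z j| ≤ 1 / (e + 1)) → ∃ N, ∀ w ∈ ⋂ n, O n,
      (∀ i < N, w i = z i) → ∀ j ≥ J, |θ (β * w) j - θ w j| ≤ 1 / (e + 1)
  jump : ∀ n e J N₀ : ℕ, ∀ z ∈ ⋂ n, O n, SmallJumps φ θ (T n) (1 / (e + 1)) J N₀ z →
    ∃ N, ∀ w ∈ ⋂ n, O n, (∀ i < N, w i = z i) → SmallJumps φ θ (T n) (1 / (e + 1)) J N₀ w

variable {Λ G : Type*} [Group Λ] [Countable Λ] [TopologicalSpace Λ] [DiscreteTopology Λ]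
  [Group G] {φ : Λ →* G} {θ : (ℕ → Λ) → ℕ → ℝ} {T : ℕ → Set G}

theorem exists_isEstimateGeneric (hθ : @Measurable _ _ (borel (ℕ → Λ)) (borel (ℕ → ℝ)) θ)
    (φ : Λ →* G) (T : ℕ → Set G) : ∃ O x, IsEstimateGeneric φ θ T O x := by
  have hΓ := countable_evConst Λ
  let _ := borel (ℕ → Λ)
  have hB : BorelSpace (ℕ → Λ) := ⟨rfl⟩
  have hθ' : Measurable θ := by
    rwa [← BorelSpace.measurable_eq (α := ℕ → ℝ)] at hθ
  have hmj : ∀ j, Measurable fun z => θ z j := fun j => (measurable_pi_apply j).comp hθ'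
  have hmβ : ∀ β : ℕ → Λ, ∀ j, Measurable fun z => θ (β * z) j := fun β j =>
    (hmj j).comp (continuous_const_mul β).measurable
  let A : (ℕ × ℚ × ℚ) ⊕ ({β : ℕ → Λ // EvConst β} × ℕ × ℕ) ⊕ (ℕ × ℕ × ℕ × ℕ) →
      Set (ℕ → Λ) := fun i =>
    match i with
    | .inl (j, p, q) => {z | (p : ℝ) < θ z j ∧ θ z j < q}
    | .inr (.inl (β, e, J)) => {z | ∀ j ≥ J, |θ (β.1 * z) j - θ z j| ≤ 1 / ((e : ℝ) + 1)}
    | .inr (.inr (n, e, J, N₀)) => {z | SmallJumps φ θ (T n) (1 / ((e : ℝ) + 1)) J N₀ z}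
  have hA : ∀ i, MeasurableSet (A i) := by
    have hle : ∀ (β : ℕ → Λ) (j : ℕ) (ε : ℝ), MeasurableSet {z | |θ (β * z) j - θ z j| ≤ ε} :=
      fun β j ε => measurableSet_le ((hmβ β j).sub (hmj j)).abs measurable_const
    rintro (⟨j, p, q⟩ | ⟨β, e, J⟩ | ⟨n, e, J, N₀⟩)
    · exact (measurableSet_lt measurable_const (hmj j)).inter
        (measurableSet_lt (hmj j) measurable_const)
    · simp only [A, Set.ofPred_forall]
      exact MeasurableSet.iInter fun j => MeasurableSet.iInter fun _ => hle _ _ _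
    · simp only [A, SmallJumps, Set.ofPred_forall]
      exact MeasurableSet.iInter fun N => MeasurableSet.iInter fun _ => MeasurableSet.iInter
        fun u => MeasurableSet.iInter fun _ => MeasurableSet.iInter fun j =>
          MeasurableSet.iInter fun _ => hle _ _ _
  obtain ⟨O, hOo, hOd, hO⟩ := exists_open_dense_seq_isOpen_inter hA
  have hO' : ∀ i, ∀ z ∈ ⋂ n, O n, z ∈ A i → ∃ N, ∀ w ∈ ⋂ n, O n, (∀ i < N, w i = z i) →
      w ∈ A i := by
    intro i z hz hzA
    obtain ⟨W, hW, hWA⟩ := hO i z hz hzA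
    obtain ⟨N, hN⟩ := exists_agree_subset_of_mem_nhds hW
    exact ⟨N, fun w hw hwz => hWA w hw (hN w hwz)⟩
  obtain ⟨x, hx⟩ := exists_forall_apply_mem_iInter
    (fun β : {β : ℕ → Λ // EvConst β} => Homeomorph.mulLeft β.1) hOo hOd
  refine ⟨O, x, hOo, fun β hβ => hx ⟨β, hβ⟩, fun z hz j ε hε => ?_,
    fun β hβ e J z hz h => hO' (.inr (.inl (⟨β, hβ⟩, e, J))) z hz h,
    fun n e J N₀ z hz h => hO' (.inr (.inr (n, e, J, N₀))) z hz h⟩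
  obtain ⟨p, hp, hp'⟩ := exists_rat_btwn (sub_lt_self (θ z j) hε)
  obtain ⟨q, hq, hq'⟩ := exists_rat_btwn (lt_add_of_pos_right (θ z j) hε)
  obtain ⟨N, hN⟩ := hO' (.inl (j, p, q)) z hz ⟨hp', hq⟩
  refine ⟨N, fun w hw hwz => ?_⟩
  obtain ⟨h1, h2⟩ := hN w hw hwz
  rw [abs_le]
  constructor <;> linarith

end Generic

/-! ### Effect of late jumps on the reduction. -/

section Jumps

theorem IsEstimateGeneric.exists_agree_mem {Λ G : Type*} [Group Λ]
    [TopologicalSpace Λ] [DiscreteTopology Λ] [Group G] {φ : Λ →* G} {θ : (ℕ → Λ) → ℕ → ℝ}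
    {T : ℕ → Set G} {O : ℕ → Set (ℕ → Λ)} {x : ℕ → Λ} (hx : IsEstimateGeneric φ θ T O x) (k : ℕ)
    {β : ℕ → Λ} (hβ : EvConst β) : ∃ N, ∀ w : ℕ → Λ, (∀ i < N, w i = (β * x) i) → w ∈ O k :=
  exists_agree_subset_of_mem_nhds ((hx.isOpen k).mem_nhds (Set.mem_iInter.1 (hx.mem β hβ) k))

variable {Λ G : Type*} [Group Λ] [Group G] [TopologicalSpace G] {φ : Λ →* G}
  {θ : (ℕ → Λ) → ℕ → ℝ} {T : ℕ → Set G} {O : ℕ → Set (ℕ → Λ)} {x : ℕ → Λ}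

theorem ReducesVia.exists_forall_ge_abs_sub_le (hred : ReducesVia φ θ) {β : ℕ → Λ}
    (hβ : EvConst β) (z : ℕ → Λ) {ε : ℝ} (hε : 0 < ε) :
    ∃ J, ∀ j ≥ J, |θ (β * z) j - θ z j| ≤ ε := by
  obtain ⟨m, hm⟩ := hβ
  have h1 : Tendsto (fun n => θ (β * z) n - θ z n) atTop (𝓝 0) := by
    refine (hred _ _).1 ⟨φ m, tendsto_const_nhds.congr' ?_⟩
    filter_upwards [hm] with i hi
    simp [hi]
  obtain ⟨J, hJ⟩ := eventually_atTop.1 (Metric.tendsto_nhds.1 h1 ε hε)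
  exact ⟨J, fun j hj => by simpa [Real.dist_eq] using (hJ j hj).le⟩

variable [TopologicalSpace Λ]

/-- Multiplying by a sequence that ends in a⁻¹ turns a late jump by a u a⁻¹ into a jump by u, and
costs one ε before and one after the jump. Genericity makes the bounds uniform in u. -/
theorem IsEstimateGeneric.exists_forall_abs_conj_jump_le (hx : IsEstimateGeneric φ θ T O x)
    (hred : ReducesVia φ θ) {n e J₁ N₁ : ℕ} {β₀ : ℕ → Λ} (hβ₀ : EvConst β₀)
    (hsmall : SmallJumps φ θ (T n) (1 / ((e : ℝ) + 1)) J₁ N₁ (β₀ * x)) {β : ℕ → Λ}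
    (hβ : EvConst β) (a : Λ) :
    ∃ J N₀, ∀ N ≥ N₀, ∀ u, φ u ∈ T n → ∀ j ≥ J,
      |θ (stepSeq N (a * u * a⁻¹) * (β * x)) j - θ (β * x) j| ≤ 3 * (1 / ((e : ℝ) + 1)) := by
  obtain ⟨M, hM⟩ := hx.jump n e J₁ N₁ _ (hx.mem _ hβ₀) hsmall
  -- Before M, α moves βx onto β₀x, where small jumps are known; afterwards it performs the
  -- conjugation.
  let α : ℕ → Λ := fun i => if i < M then β₀ i * (β i)⁻¹ else a⁻¹
  have hα : EvConst α := ⟨a⁻¹, eventually_atTop.2 ⟨M, fun i hi => if_neg (not_lt.2 hi)⟩⟩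
  have hw := hM (α * (β * x)) (by rw [← mul_assoc]; exact hx.mem _ (hα.mul hβ)) fun i hi => by
    simp [α, hi]
  obtain ⟨J₂, hJ₂⟩ := hred.exists_forall_ge_abs_sub_le hα (β * x)
    (ε := 1 / ((e : ℝ) + 1)) (by positivity)
  obtain ⟨N₂, hN₂⟩ := hx.mul α hα e J₂ _ (hx.mem _ hβ) hJ₂
  refine ⟨max J₁ J₂, max N₁ (max M N₂), fun N hN u hu j hj => ?_⟩
  have hN1 : N₁ ≤ N := (le_max_left _ _).trans hN
  have hNM : M ≤ N := ((le_max_left _ _).trans (le_max_right _ _)).trans hN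
  have hN2 : N₂ ≤ N := ((le_max_right _ _).trans (le_max_right _ _)).trans hN
  have hmove : α * (stepSeq N (a * u * a⁻¹) * (β * x)) = stepSeq N u * (α * (β * x)) := by
    ext i
    rcases lt_or_ge i N with hi | hi
    · simp [stepSeq_of_lt _ hi]
    · simp [stepSeq_of_le _ hi, α, not_lt.2 (hNM.trans hi), mul_assoc]
  have h1 := hw N hN1 u hu j ((le_max_left _ _).trans hj)
  have h2 := hJ₂ j ((le_max_right _ _).trans hj)
  have h3 := hN₂ (stepSeq N (a * u * a⁻¹) * (β * x))
    (by rw [← mul_assoc]; exact hx.mem _ ((evConst_stepSeq _ _).mul hβ))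
    (fun i hi => by
      rw [Pi.mul_apply, stepSeq_of_lt _ (hi.trans_le hN2), one_mul])
    j ((le_max_right _ _).trans hj)
  rw [hmove] at h3
  have h4 := abs_sub_le (θ (stepSeq N (a * u * a⁻¹) * (β * x)) j)
    (θ (stepSeq N u * (α * (β * x))) j) (θ (β * x) j)
  have h5 := abs_sub_le (θ (stepSeq N u * (α * (β * x))) j) (θ (α * (β * x)) j) (θ (β * x) j)
  rw [abs_sub_comm] at h3
  linarith

variable [DiscreteTopology Λ]

/-- Otherwise bad jumps by elements of T k, each later cancelled, fuse to a y with φ(y x⁻¹) → 1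
whose θ-value differs from that of x by a fixed amount at infinitely many coordinates. -/
theorem IsEstimateGeneric.exists_smallJumps (hx : IsEstimateGeneric φ θ T O x)
    (hred : ReducesVia φ θ) (hT : (𝓝 (1 : G)).HasAntitoneBasis T) (e : ℕ) :
    ∃ n β J N₀, EvConst β ∧ SmallJumps φ θ (T n) (1 / ((e : ℝ) + 1)) J N₀ (β * x) := by
  by_contra! hno
  have hε : (0 : ℝ) < 1 / ((e : ℝ) + 1) := by positivity
  generalize 1 / ((e : ℝ) + 1) = ε at hno hε
  have h1T : ∀ n, (1 : G) ∈ T n := fun n => mem_of_mem_nhds (hT.1.mem_of_mem trivial)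
  have hev : ∀ {β : ℕ → Λ}, (∀ᶠ i in atTop, β i = 1) → EvConst β := fun h => ⟨1, h⟩
  obtain ⟨s, N, y, -, hR, hyC, hgood, hN, hagree⟩ := exists_fusion (O := O)
    (S := {β : ℕ → Λ // ∀ᶠ i in atTop, β i = 1} × ℕ) (fun s => s.1.1 * x)
    (fun k s s' => k ≤ s'.2 ∧ ε / 2 ≤ |θ (s'.1.1 * x) s'.2 - θ x s'.2| ∧
      ∀ i, s'.1.1 i = s.1.1 i ∨ φ (s'.1.1 i) ∈ T k)
    (fun k s y => |θ y s.2 - θ (s.1.1 * x) s.2| ≤ ε / 4)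
    (fun k s => hx.exists_agree_mem k (hev s.1.2))
    (fun k s => hx.cont _ (hx.mem _ (hev s.1.2)) _ _ (by positivity))
    (fun k s N => by
      obtain ⟨⟨β, hβ⟩, b⟩ := s
      obtain ⟨J, hJ⟩ := hred.exists_forall_ge_abs_sub_le (hev hβ) x (ε := ε / 4) (by positivity)
      obtain ⟨M, hM⟩ := eventually_atTop.1 hβ
      have h1 := hno k β (max J k) (max N M) (hev hβ)
      simp only [SmallJumps, not_forall, not_le] at h1
      obtain ⟨N₁, hN₁, u, hu, j, hj, hlt⟩ := h1
      have hz : stepSeq N₁ u * β * x ∈ ⋂ n, O n := hx.mem _ ((evConst_stepSeq _ _).mul (hev hβ))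
      obtain ⟨N₂, hN₂⟩ := hx.cont _ hz j (ε / 4) (by positivity)
      have hNN : N ≤ N₁ := (le_max_left _ _).trans hN₁
      have hMN : M ≤ N₁ := (le_max_right _ _).trans hN₁
      -- The jump is undone after N₂, so β' is again eventually 1; continuity loses only ε/4 at
      -- coordinate j, and ε - ε/4 - ε/4 = ε/2 remains.
      let β' : ℕ → Λ := stepSeq (max N₁ N₂) u⁻¹ * (stepSeq N₁ u * β)
      have hβlt : ∀ i < max N₁ N₂, β' i = (stepSeq N₁ u * β) i := fun i hi => by
        simp [β', stepSeq_of_lt _ hi]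
      have hβge : ∀ i ≥ max N₁ N₂, β' i = 1 := fun i hi => by
        have h2 : N₁ ≤ i := (le_max_left _ _).trans hi
        simp [β', stepSeq_of_le _ hi, stepSeq_of_le _ h2, hM i (hMN.trans h2)]
      have hβ' : ∀ᶠ i in atTop, β' i = 1 := eventually_atTop.2 ⟨_, hβge⟩
      have hclose := hN₂ (β' * x) (hx.mem _ (hev hβ')) fun i hi => by
        rw [Pi.mul_apply, hβlt i (hi.trans_le (le_max_right _ _)), Pi.mul_apply _ x]
      refine ⟨⟨⟨β', hβ'⟩, j⟩, ⟨(le_max_right _ _).trans hj, ?_, fun i => ?_⟩, fun i hi => ?_⟩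
      · have h2 := hJ j ((le_max_left _ _).trans hj)
        rw [← mul_assoc] at hlt
        have h3 := abs_sub_le (θ (stepSeq N₁ u * β * x) j) (θ (β' * x) j) (θ (β * x) j)
        have h4 := abs_sub_le (θ (β' * x) j) (θ x j) (θ (β * x) j)
        rw [abs_sub_comm] at hclose
        rw [abs_sub_comm] at h2
        dsimp only
        linarith
      · rcases lt_or_ge i (max N₁ N₂) with hi | hi
        · rcases lt_or_ge i N₁ with hi' | hi'
          · left
            simp [hβlt i hi, stepSeq_of_lt _ hi']
          · right
            simpa [hβlt i hi, stepSeq_of_le _ hi', hM i (hMN.trans hi')] using hu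
        · left
          dsimp only
          rw [hβge i hi, hM i (hMN.trans ((le_max_left _ _).trans hi))]
      · have hi' : i < N₁ := hi.trans_le hNN
        dsimp only
        rw [Pi.mul_apply, hβlt i (hi'.trans_le (le_max_left _ _)), Pi.mul_apply, Pi.mul_apply,
          stepSeq_of_lt _ hi', one_mul])
    ⟨⟨1, Eventually.of_forall fun _ => rfl⟩, 0⟩
  have hyx : Tendsto (fun n => θ y n - θ x n) atTop (𝓝 0) := by
    refine (hred _ _).1 ⟨1, fun U hU => ?_⟩
    obtain ⟨m, -, hm⟩ := hT.1.mem_iff.1 hU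
    obtain ⟨M, hM⟩ := eventually_atTop.1 (s m).1.2
    have hind : ∀ k ≥ m, ∀ i ≥ M, φ ((s k).1.1 i) ∈ T m := by
      intro k hk
      induction k, hk using Nat.le_induction with
      | base => exact fun i hi => by rw [hM i hi, map_one]; exact h1T m
      | succ k hk ih =>
        intro i hi
        rcases (hR k).2.2 i with h | h
        · rw [h]; exact ih i hi
        · exact hT.antitone hk h
    refine eventually_atTop.2 ⟨M, fun i hi => hm ?_⟩
    have h2 := hagree (max m (i + 1)) i ((Nat.lt_succ_self i).trans_le
      ((le_max_right _ _).trans (hN _)))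
    have h3 := hind (max m (i + 1)) (le_max_left _ _) i hi
    dsimp only
    rwa [h2, Pi.mul_apply, map_mul, mul_inv_cancel_right]
  obtain ⟨J, hJ⟩ := eventually_atTop.1 (Metric.tendsto_nhds.1 hyx (ε / 4) (by positivity))
  obtain ⟨h1, h2, -⟩ := hR J
  have h3 := hJ _ h1
  have h4 := hgood (J + 1)
  rw [Real.dist_eq, sub_zero] at h3
  have h5 := abs_sub_le (θ ((s (J + 1)).1.1 * x) (s (J + 1)).2) (θ y (s (J + 1)).2)
    (θ x (s (J + 1)).2)
  rw [abs_sub_comm] at h4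
  linarith

end Jumps

/-! ### Normal closures as walks by conjugates. -/

section Walks

theorem exists_eventually_eq_of_reflTransGen {α : Type*} {r : α → α → Prop} (hr : ∀ a, r a a)
    {a b : α} (h : Relation.ReflTransGen r a b) :
    ∃ (f : ℕ → α) (l : ℕ), f 0 = a ∧ f l = b ∧ ∀ i, r (f i) (f (i + 1)) := by
  induction h using Relation.ReflTransGen.head_induction_on with
  | refl => exact ⟨fun _ => b, 0, rfl, rfl, fun _ => hr b⟩
  | head hac _ ih =>
    obtain ⟨f, l, h0, hl, hf⟩ := ih
    rename_i a₁ c₁ _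
    refine ⟨fun i => Nat.casesOn i a₁ f, l + 1, rfl, hl, ?_⟩
    rintro (_ | i)
    · simpa [h0] using hac
    · exact hf i

/-- Infinitely many walks with matching endpoints concatenate to a single sequence. -/
theorem exists_seq_of_reflTransGen {α : Type*} {r : ℕ → α → α → Prop} {c : ℕ → α}
    (hr : ∀ n a, r n a a) (hc : ∀ n, Relation.ReflTransGen (r n) (c n) (c (n + 1))) :
    ∃ (m : ℕ → α) (ν : ℕ → ℕ), Tendsto ν atTop atTop ∧ (∀ k, r (ν k) (m k) (m (k + 1))) ∧
      m 0 = c 0 ∧ ∀ n, ∃ k ≥ n, m k = c n := by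
  choose f l h0 hl hf using fun n => exists_eventually_eq_of_reflTransGen (hr n) (hc n)
  -- The pair records the current walk and the position in it; passing to the next walk is a
  -- stationary step, since the endpoints match.
  let q : ℕ → ℕ × ℕ := fun k => Nat.rec (0, 0) (fun _ p =>
    if p.2 < l p.1 then (p.1, p.2 + 1) else (p.1 + 1, 0)) k
  have hq : ∀ k, q (k + 1) = if (q k).2 < l (q k).1 then ((q k).1, (q k).2 + 1)
    else ((q k).1 + 1, 0) := fun k => rfl
  have hle : ∀ k, (q k).2 ≤ l (q k).1 := by
    intro k
    induction k with
    | zero => exact Nat.zero_le _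
    | succ k ih =>
      rw [hq]
      split_ifs with h
      exacts [h, Nat.zero_le _]
  have hνk : ∀ k, (q k).1 ≤ k := by
    intro k
    induction k with
    | zero => exact le_rfl
    | succ k ih =>
      rw [hq]
      split_ifs
      · exact ih.trans (Nat.le_succ k)
      · exact Nat.succ_le_succ ih
  have hmono : Monotone fun k => (q k).1 := by
    refine monotone_nat_of_le_succ fun k => ?_
    rw [hq]
    split_ifs
    exacts [le_rfl, Nat.le_succ _]
  have hadv : ∀ d k, l (q k).1 - (q k).2 = d → ∃ k', q k' = ((q k).1 + 1, 0) := by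
    intro d
    induction d with
    | zero =>
      intro k hk
      exact ⟨k + 1, by rw [hq, if_neg (by omega)]⟩
    | succ d ih =>
      intro k hk
      have hk1 : q (k + 1) = ((q k).1, (q k).2 + 1) := by rw [hq, if_pos (by omega)]
      obtain ⟨k', hk'⟩ := ih (k + 1) (by rw [hk1]; dsimp only; omega)
      exact ⟨k', by rw [hk', hk1]⟩
  have hvisit : ∀ n, ∃ k, q k = (n, 0) := by
    intro n
    induction n with
    | zero => exact ⟨0, rfl⟩
    | succ n ih =>
      obtain ⟨k, hk⟩ := ih
      obtain ⟨k', hk'⟩ := hadv _ k rfl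
      exact ⟨k', by rw [hk', hk]⟩
  refine ⟨fun k => f (q k).1 (q k).2, fun k => (q k).1,
    tendsto_atTop_atTop_of_monotone hmono fun n => ?_, fun k => ?_, h0 0, fun n => ?_⟩
  · obtain ⟨k, hk⟩ := hvisit n
    exact ⟨k, by rw [hk]⟩
  · dsimp only
    rw [hq]
    split_ifs with h
    · exact hf _ _
    · have h1 : (q k).2 = l (q k).1 := le_antisymm (hle k) (not_lt.1 h)
      rw [h0, h1, hl]
      exact hr _ _
  · obtain ⟨k, hk⟩ := hvisit n
    refine ⟨k, ?_, by simp only [hk, h0]⟩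
    have := hνk k
    rwa [hk] at this

theorem reflTransGen_of_mem_normalClosure {Λ : Type*} [Group Λ] {S : Set Λ}
    (hS : ∀ u ∈ S, u⁻¹ ∈ S) {g : Λ} (hg : g ∈ Subgroup.normalClosure S) :
    Relation.ReflTransGen (fun p q => ∃ a, ∃ u ∈ S, q = a * u * a⁻¹ * p) 1 g := by
  induction hg using Subgroup.closure_induction_left with
  | one => exact .refl
  | mul_left c hc y _ ih =>
    obtain ⟨u, hu, huc⟩ := Group.mem_conjugatesOfSet_iff.1 hc
    obtain ⟨a, rfl⟩ := isConj_iff.1 huc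
    exact ih.tail ⟨a, u, hu, rfl⟩
  | inv_mul_cancel c hc y _ ih =>
    obtain ⟨u, hu, huc⟩ := Group.mem_conjugatesOfSet_iff.1 hc
    obtain ⟨a, rfl⟩ := isConj_iff.1 huc
    exact ih.tail ⟨a, u⁻¹, hS u hu, by group⟩

/-- Finitely many conjugators and generators suffice, so countably many memberships can be lifted to
a countable group. -/
theorem exists_finite_mem_closure_of_mem_normalClosure {G : Type*} [Group G] {T : Set G} {g : G}
    (hg : g ∈ Subgroup.normalClosure T) : ∃ F : Set G, F.Finite ∧
      g ∈ Subgroup.closure {h | ∃ c ∈ F, ∃ u ∈ F, u ∈ T ∧ h = c * u * c⁻¹} := by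
  have hmono : ∀ {F F' : Set G}, F ⊆ F' →
      Subgroup.closure {h | ∃ c ∈ F, ∃ u ∈ F, u ∈ T ∧ h = c * u * c⁻¹} ≤
        Subgroup.closure {h | ∃ c ∈ F', ∃ u ∈ F', u ∈ T ∧ h = c * u * c⁻¹} := by
    intro F F' hF
    refine Subgroup.closure_mono ?_
    rintro h ⟨c, hc, u, hu, huT, rfl⟩
    exact ⟨c, hF hc, u, hF hu, huT, rfl⟩
  induction hg using Subgroup.closure_induction with
  | mem h hh =>
    obtain ⟨u, hu, huc⟩ := Group.mem_conjugatesOfSet_iff.1 hh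
    obtain ⟨a, rfl⟩ := isConj_iff.1 huc
    exact ⟨{a, u}, Set.toFinite _, Subgroup.subset_closure
      ⟨a, Or.inl rfl, u, Or.inr rfl, hu, rfl⟩⟩
  | one => exact ⟨∅, Set.finite_empty, one_mem _⟩
  | mul a b _ _ iha ihb =>
    obtain ⟨F, hF, ha⟩ := iha
    obtain ⟨F', hF', hb⟩ := ihb
    exact ⟨F ∪ F', hF.union hF', mul_mem (hmono Set.subset_union_left ha)
      (hmono Set.subset_union_right hb)⟩
  | inv a _ iha =>
    obtain ⟨F, hF, ha⟩ := iha
    exact ⟨F, hF, inv_mem ha⟩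

end Walks

/-! ### The rigidity argument and the lifting to a countable group. -/

section Main

theorem ReducesVia.false_of_mem_normalClosure {Λ G : Type*} [Group Λ] [Countable Λ]
    [TopologicalSpace Λ] [DiscreteTopology Λ] [Group G] [TopologicalSpace G] [T2Space G]
    {φ : Λ →* G} {θ : (ℕ → Λ) → ℕ → ℝ} {T : ℕ → Set G}
    (hθ : @Measurable _ _ (borel (ℕ → Λ)) (borel (ℕ → ℝ)) θ)
    (hred : ReducesVia φ θ) (hT : (𝓝 (1 : G)).HasAntitoneBasis T)
    (hTinv : ∀ n, ∀ g ∈ T n, g⁻¹ ∈ T n) {V : Set G} (hV : V ∈ 𝓝 1) {a : ℕ → Λ}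
    (ha : ∀ n, a n ∈ Subgroup.normalClosure (φ ⁻¹' T n)) (haV : ∀ n, φ (a n) ∉ V) : False := by
  obtain ⟨O, x, hx⟩ := exists_isEstimateGeneric hθ φ T
  have h1T : ∀ n, (1 : G) ∈ T n := fun n => mem_of_mem_nhds (hT.1.mem_of_mem trivial)
  choose t β₀ J₁ N₁ hβ₀ hsmall using fun e => hx.exists_smallJumps hred hT e
  let ρ : ℕ → Λ → Λ → Prop := fun e p q => ∃ b, ∃ u ∈ φ ⁻¹' T (t e), q = b * u * b⁻¹ * p
  have hTinv' : ∀ n, ∀ u ∈ φ ⁻¹' T n, u⁻¹ ∈ φ ⁻¹' T n := fun n u hu => by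
    simpa using hTinv n _ hu
  have hρrefl : ∀ e p, ρ e p p := fun e p => ⟨1, 1, by simpa using h1T _, by simp⟩
  have hρsymm : ∀ e, Std.Symm (ρ e) := by
    refine fun e => ⟨?_⟩
    rintro p _ ⟨b, u, hu, rfl⟩
    exact ⟨b, u⁻¹, hTinv' _ u hu, by group⟩
  have hreach : ∀ e n, t e ≤ n → Relation.ReflTransGen (ρ e) 1 (a n) := fun e n hn =>
    reflTransGen_of_mem_normalClosure (hTinv' _)
      (Subgroup.normalClosure_mono (Set.preimage_mono (hT.antitone hn)) (ha n))
  -- The index at odd n dominates both t(n-1) and t(n), so the target can be reached from 1 with the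
  -- steps of walk n-1 and left again with those of walk n.
  let c : ℕ → Λ := fun n => if n % 2 = 0 then 1 else a (max (t (n - 1)) (t n))
  have hc0 : ∀ p, c (2 * p) = 1 := fun p => by simp [c]
  have hc1 : ∀ p, c (2 * p + 1) = a (max (t (2 * p)) (t (2 * p + 1))) := fun p => by
    simp [c, Nat.add_mod]
  obtain ⟨m, ν, hν, hstep, hm0, hvisit⟩ := exists_seq_of_reflTransGen (r := ρ) (c := c) hρrefl
    fun n => by
      obtain ⟨p, rfl | rfl⟩ := Nat.even_or_odd' n
      · rw [hc0, hc1]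
        exact hreach _ _ (le_max_left _ _)
      · rw [hc1, show 2 * p + 1 + 1 = 2 * (p + 1) by ring, hc0]
        have := hρsymm (2 * p + 1)
        exact Std.Symm.symm _ _ (hreach _ _ (le_max_right _ _))
  choose b u hu hbu using hstep
  -- A state is a time k with a multiplier that has eventual value m k.
  let S := {p : ℕ × (ℕ → Λ) // ∀ᶠ i in atTop, p.2 i = m p.1}
  have hS : ∀ s : S, EvConst s.1.2 := fun s => ⟨_, s.2⟩
  have hJ : ∀ s : S, ∃ J N₀, s.1.1 ≤ J ∧
      (∀ j ≥ J, |θ (s.1.2 * x) j - θ x j| ≤ 1 / ((s.1.1 : ℝ) + 1)) ∧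
      ∀ N ≥ N₀, ∀ j ≥ J, |θ (stepSeq N (b s.1.1 * u s.1.1 * (b s.1.1)⁻¹) * (s.1.2 * x)) j -
        θ (s.1.2 * x) j| ≤ 3 * (1 / ((ν s.1.1 : ℝ) + 1)) := by
    intro s
    obtain ⟨J, hJ⟩ := hred.exists_forall_ge_abs_sub_le (hS s) x
      (ε := 1 / ((s.1.1 : ℝ) + 1)) (by positivity)
    obtain ⟨J', N₀, hJ'⟩ := hx.exists_forall_abs_conj_jump_le hred (hβ₀ (ν s.1.1))
      (hsmall (ν s.1.1)) (hS s) (b s.1.1)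
    exact ⟨max s.1.1 (max J J'), N₀, le_max_left _ _,
      fun j hj => hJ j (((le_max_left _ _).trans (le_max_right _ _)).trans hj),
      fun N hN j hj => hJ' N hN _ (hu _) j (((le_max_right _ _).trans (le_max_right _ _)).trans hj)⟩
  choose J N₀ hJge hJx hJjump using hJ
  obtain ⟨s, N, y, hs0, hR, hyC, hgood, -, -⟩ := exists_fusion (O := O) (S := S)
    (fun s => s.1.2 * x)
    (fun _ s s' => s'.1.1 = s.1.1 + 1 ∧
      ∀ j ≥ J s, |θ (s'.1.2 * x) j - θ (s.1.2 * x) j| ≤ 3 * (1 / ((ν s.1.1 : ℝ) + 1)))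
    (fun _ s y => (∃ i ≥ s.1.1, y i = m s.1.1 * x i) ∧
      ∀ j ≤ J s, |θ y j - θ (s.1.2 * x) j| ≤ 1 / ((s.1.1 : ℝ) + 1))
    (fun k s => hx.exists_agree_mem k (hS s))
    (fun _ s => by
      obtain ⟨M, hM⟩ := eventually_atTop.1 s.2
      choose L hL using fun j => hx.cont _ (hx.mem _ (hS s)) j
        (1 / ((s.1.1 : ℝ) + 1)) (by positivity)
      refine ⟨max (max s.1.1 M + 1) ((Finset.range (J s + 1)).sup L), fun w hw hwz =>
        ⟨⟨max s.1.1 M, le_max_left _ _, ?_⟩, fun j hj => hL j w hw fun i hi => hwz i ?_⟩⟩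
      · rw [hwz _ ((Nat.lt_succ_self _).trans_le (le_max_left _ _)), Pi.mul_apply,
          hM _ (le_max_right _ _)]
      · refine (hi.trans_le ?_).trans_le (le_max_right _ _)
        exact Finset.le_sup (f := L) (Finset.mem_range.2 (Nat.lt_succ_of_le hj)))
    (fun _ s N => by
      let K := max N (N₀ s)
      let d := stepSeq K (b s.1.1 * u s.1.1 * (b s.1.1)⁻¹)
      refine ⟨⟨(s.1.1 + 1, d * s.1.2), ?_⟩, ⟨rfl, fun j hj => ?_⟩, fun i hi => ?_⟩
      · filter_upwards [s.2, eventually_ge_atTop K] with i hi hiK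
        rw [Pi.mul_apply, hi, hbu]
        exact congrArg (· * m s.1.1) (stepSeq_of_le _ hiK)
      · have := hJjump s K (le_max_right _ _) j hj
        rwa [← mul_assoc] at this
      · have hd : d i = 1 := stepSeq_of_lt _ (hi.trans_le (le_max_left N (N₀ s)))
        simp [hd])
    ⟨(0, 1), Eventually.of_forall fun i => by
      rw [hm0, show (0 : ℕ) = 2 * 0 from rfl, hc0]; rfl⟩
  have hsk : ∀ k, (s k).1.1 = k := by
    intro k
    induction k with
    | zero => rw [hs0]
    | succ k ih => rw [(hR k).1, ih]
  have hyx : Tendsto (fun n => θ y n - θ x n) atTop (𝓝 0) := by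
    rw [Metric.tendsto_nhds]
    intro ε hε
    have hlim : Tendsto (fun k : ℕ => 1 / ((k : ℝ) + 1)) atTop (𝓝 0) :=
      tendsto_one_div_add_atTop_nhds_zero_nat
    obtain ⟨K, hK⟩ := eventually_atTop.1 ((hlim.eventually (gt_mem_nhds (by positivity :
      0 < ε / 8))).and ((hlim.comp hν).eventually (gt_mem_nhds (by positivity : 0 < ε / 8))))
    refine eventually_atTop.2 ⟨J (s K), fun j hj => ?_⟩
    -- Coordinate j sees one step only: before stage k the state is close to x there, after stage k
    -- + 1 it is close to y. The total is at most (1 + 3 + 1)ε/8.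
    obtain ⟨k, hKk, hk, hk'⟩ : ∃ k ≥ K, J (s k) ≤ j ∧ j < J (s (k + 1)) := by
      by_contra! hno
      have hall : ∀ k ≥ K, J (s k) ≤ j := by
        intro k hk
        induction k, hk using Nat.le_induction with
        | base => exact hj
        | succ k hk ih => exact hno k hk ih
      have h1 := hall (max K (j + 1)) (le_max_left _ _)
      have h2 := hJge (s (max K (j + 1)))
      rw [hsk] at h2
      omega
    have h1 := (hgood (k + 1)).2 j hk'.le
    have h2 := (hR k).2 j hk
    have h3 := hJx (s k) j hk
    rw [hsk] at h1 h2 h3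
    have h4 := (hK (k + 1) (by omega)).1
    have h5 := (hK k hKk).1
    have h6 := (hK k hKk).2
    simp only [Function.comp_apply] at h6
    rw [Real.dist_eq, sub_zero]
    have h7 := abs_sub_le (θ y j) (θ ((s (k + 1)).1.2 * x) j) (θ x j)
    have h8 := abs_sub_le (θ ((s (k + 1)).1.2 * x) j) (θ ((s k).1.2 * x) j) (θ x j)
    linarith
  obtain ⟨g, hg⟩ := (hred y x).2 hyx
  -- Each value m k is read off from y at some late coordinate, so convergence of φ(y x⁻¹) forces
  -- convergence of the walk.
  choose i hi hiy using fun k => (hgood k).1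
  have hi' : Tendsto i atTop atTop := tendsto_atTop_mono (fun k => by
    have := hi k; rwa [hsk] at this) tendsto_id
  have hmg : Tendsto (fun k => φ (m k)) atTop (𝓝 g) := by
    refine (hg.comp hi').congr fun k => ?_
    simp [hiy, hsk]
  choose κ hκ hκc using hvisit
  have hκ' : Tendsto κ atTop atTop := tendsto_atTop_mono hκ tendsto_id
  have hcg : Tendsto (fun n => φ (c n)) atTop (𝓝 g) :=
    (hmg.comp hκ').congr fun n => by simp [hκc]
  have hg1 : g = 1 := by
    refine tendsto_nhds_unique (hcg.comp (tendsto_atTop_mono (fun p : ℕ => ?_) tendsto_id :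
      Tendsto (fun p => 2 * p) atTop atTop)) ?_
    · dsimp; omega
    · simp [Function.comp_def, hc0]
  subst hg1
  have hodd : Tendsto (fun p => 2 * p + 1) atTop atTop :=
    tendsto_atTop_mono (fun p : ℕ => by dsimp; omega) tendsto_id
  obtain ⟨p, hp⟩ := ((hcg.comp hodd).eventually hV).exists
  simp only [Function.comp_apply, hc1] at hp
  exact haV _ hp

variable {G : Type*} [Group G] [TopologicalSpace G] [IsTopologicalGroup G]

theorem exists_antitone_basis_inv_mem [FirstCountableTopology G] :
    ∃ T : ℕ → Set G, (𝓝 (1 : G)).HasAntitoneBasis T ∧ ∀ n, ∀ g ∈ T n, g⁻¹ ∈ T n := by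
  obtain ⟨T, hT⟩ := (𝓝 (1 : G)).exists_antitone_basis
  have hTn : ∀ n, T n ∈ 𝓝 (1 : G) := fun n => hT.1.mem_of_mem trivial
  refine ⟨fun n => T n ∩ (T n)⁻¹, ⟨⟨fun U => ?_⟩, fun i j hij => ?_⟩, fun n g hg =>
    ⟨hg.2, by simpa using hg.1⟩⟩
  · constructor
    · intro hU
      obtain ⟨n, -, hn⟩ := hT.1.mem_iff.1 hU
      exact ⟨n, trivial, Set.inter_subset_left.trans hn⟩
    · rintro ⟨n, -, hn⟩
      exact mem_of_superset (inter_mem (hTn n) (inv_mem_nhds_one G (hTn n))) hn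
  · exact Set.inter_subset_inter (hT.antitone hij) (Set.inv_subset_inv.2 (hT.antitone hij))

theorem hasOpenNormalBasis_of_borelReducible_eqvRc0 [PolishSpace G]
    (h : BorelReducible (eqvGroup G) eqvRc0) : HasOpenNormalBasis G := by
  refine hasOpenNormalBasis_of_normalClosure ?_
  by_contra! hno
  obtain ⟨V, hV, hno⟩ := hno
  obtain ⟨T, hT, hTinv⟩ := exists_antitone_basis_inv_mem (G := G)
  obtain ⟨f, hf, hfred⟩ := h
  choose g hg hgV using fun n => Set.not_subset.1 (hno (T n) (hT.1.mem_of_mem trivial))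
  choose F hF hgF using fun n => exists_finite_mem_closure_of_mem_normalClosure (hg n)
  let A : Set G := ⋃ n, F n
  have hA : Countable A := Set.countable_iUnion fun n => (hF n).countable
  -- A countable discrete source makes eventually constant translations countable and neighbourhoods
  -- of sequences finitary.
  let φ : FreeGroup A →* G := FreeGroup.lift Subtype.val
  let _ : TopologicalSpace (FreeGroup A) := ⊥
  have : DiscreteTopology (FreeGroup A) := ⟨rfl⟩
  have hlift : ∀ n, ∃ a ∈ Subgroup.normalClosure (φ ⁻¹' T n), φ a = g n := by
    intro n
    have hle : Subgroup.closure {h | ∃ c ∈ F n, ∃ u ∈ F n, u ∈ T n ∧ h = c * u * c⁻¹} ≤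
        (Subgroup.normalClosure (φ ⁻¹' T n)).map φ := by
      refine (Subgroup.closure_le _).2 ?_
      rintro _ ⟨c, hc, u, hu, huT, rfl⟩
      let c' : A := ⟨c, Set.mem_iUnion.2 ⟨n, hc⟩⟩
      let u' : A := ⟨u, Set.mem_iUnion.2 ⟨n, hu⟩⟩
      refine ⟨FreeGroup.of c' * FreeGroup.of u' * (FreeGroup.of c')⁻¹, ?_, by simp [φ, c', u']⟩
      refine Subgroup.normalClosure_normal.conj_mem _ (Subgroup.subset_normalClosure ?_) _
      simpa [φ, u'] using huT
    exact hle (hgF n)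
  choose a ha hag using hlift
  have hφ : Continuous fun (x : ℕ → FreeGroup A) n => φ (x n) :=
    continuous_pi fun n => continuous_of_discreteTopology.comp (continuous_apply n)
  refine ReducesVia.false_of_mem_normalClosure (φ := φ) (θ := fun x => f fun n => φ (x n))
    (@Measurable.comp _ _ _ (borel (ℕ → FreeGroup A)) (borel (ℕ → G)) (borel (ℕ → ℝ)) _ _ hf
      hφ.measurable_borel)
    (fun x y => hfred _ _) hT hTinv hV ha fun n => by rw [hag]; exact hgV n

end Main

theorem mainTheorem2 (G : Type*) [Group G] [TopologicalSpace G] [IsTopologicalGroup G]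
    [PolishSpace G] :
    List.TFAE [
      IsTSI G ∧ NonarchimedeanGroup G,
      BorelReducible (eqvGroup G) (eqvOmega eqvE0),
      BorelReducible (eqvGroup G) eqvRc0] ∧
    (BorelBireducible (eqvGroup G) (eqvOmega eqvE0) ↔
      IsTSI G ∧ Uncountable G ∧ NonarchimedeanGroup G) ∧
    ¬ (StrictlyBorelReducible (eqvOmega eqvE0) (eqvGroup G) ∧
      BorelReducible (eqvGroup G) eqvRc0) := by
  rw [← hasOpenNormalBasis_iff]
  have h12 : HasOpenNormalBasis G → BorelReducible (eqvGroup G) (eqvOmega eqvE0) :=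
    fun h => h.borelReducible_eqvOmega_eqvE0
  have h23 : BorelReducible (eqvGroup G) (eqvOmega eqvE0) → BorelReducible (eqvGroup G) eqvRc0 :=
    fun h => h.trans eqvOmega_eqvE0_borelReducible_eqvRc0
  have h31 : BorelReducible (eqvGroup G) eqvRc0 → HasOpenNormalBasis G :=
    hasOpenNormalBasis_of_borelReducible_eqvRc0
  refine ⟨?_, ⟨fun h => ?_, fun h => ?_⟩, fun h => h.1.2 (h12 (h31 h.2))⟩
  · tfae_have 1 → 2 := h12
    tfae_have 2 → 3 := h23
    tfae_have 3 → 1 := h31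
    tfae_finish
  · have h1 := h31 (h23 h.1)
    refine ⟨h1.isTSI, ?_, h1.nonarchimedeanGroup⟩
    by_contra hcount
    rw [not_uncountable_iff] at hcount
    exact not_borelReducible_eqvGroup_of_countable h.2
  · obtain ⟨h1, h2, h3⟩ := h
    have h4 := hasOpenNormalBasis_of_isTSI h1 h3
    exact ⟨h12 h4, h4.eqvOmega_eqvE0_borelReducible⟩
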